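/- For $n\ge 1$ let $S_n$ be the symmetric group on $n$ letters and, for $\sigma\in S_n$, let $\alpha_j(\sigma)$ be the number of cycles of length $j$ of $\sigma$ (fixed points are cycles of length $1$). A sequence $\hat F(1),\hat F(2),\dots$ of numbers determines on every $S_m$ the multiplicative function $F(\sigma)=\prod_{j=1}^{m}\hat F(j)^{\alpha_j(\sigma)}$ (with $0^0=1$). For all real numbers $d^-,d^+$ with $0<d^-\le d^+$ there is a constant $c_1=c_1(d^-,d^+)>0$, depending on $d^-$ and $d^+$ only, such that the following holds for every $n\ge 1$, every real sequence $(\hat d(j))_{j\ge1}$ with $d^-\le\hat d(j)\le d^+$ for $1\le j\le n$, and every complex sequence $(\hat f(j))_{j\ge1}$ with $|\hat f(j)|\le 1$ for $1\le j\le n$. Let $d$ and $f$ be the multiplicative functions determined by $\hat d$ and $\hat f$, and put $$\nu_{n,d}(\sigma)=\frac{d(\sigma)}{\sum_{\tau\in S_n}d(\tau)},\qquad M_n^d(f)=\sum_{\sigma\in S_n}f(\sigma)\,\nu_{n,d}(\sigma),\qquad p_k=\frac1{k!}\sum_{\sigma\in S_k}d(\sigma)\quad(k\ge 0),$$ $$\Delta_n=\left|M_n^d(f)-\exp\left\{\sum_{j=1}^n\hat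 d(j)\frac{\hat f(j)-1}{j}\right\}\right| .$$ Then $p_k=[z^k]\exp\bigl\{\sum_{j=1}^\infty\frac{\hat d(j)}{j}z^j\bigr\}$ for all $k\ge 0$ (coefficient of the formal power series). If $d^-<1$, then $$\Delta_n\le c_1\left(\Bigl(\sum_{j=0}^np_j\Bigr)^{-1}\sum_{k=1}^n|\hat f(k)-1|\,p_{n-k}+\frac1{n^{d^-}}\sum_{k=1}^n|\hat f(k)-1|\,k^{d^--1}+\frac1n\sum_{k=1}^n|\hat f(k)-1|\right),$$ and if $d^-\ge 1$, then $$\Delta_n\le c_1\left(\Bigl(\sum_{j=0}^np_j\Bigr)^{-1}\sum_{k=1}^n|\hat f(k)-1|\,p_{n-k}+\frac1n\sum_{k=1}^n|\hat f(k)-1|\Bigl(1+\log\frac nk\Bigr)\right).$$ -/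

import Mathlib

open Finset

/-- `cycleCount σ j` is the number `α_j(σ)` of cycles of length `j` of the permutation `σ`
of an `n`-element set, fixed points being the cycles of length `1`. -/
def cycleCount {n : ℕ} (σ : Equiv.Perm (Fin n)) (j : ℕ) : ℕ :=
  σ.partition.parts.count j

/-- The multiplicative function on `S_n` determined by the values `F 1, …, F n`:
the product over `1 ≤ j ≤ n` of `F j ^ α_j(σ)`, with `0 ^ 0 = 1`. -/
def multFun {R : Type*} [CommMonoid R] (F : ℕ → R) {n : ℕ} (σ : Equiv.Perm (Fin n)) : R :=
  ∏ j ∈ Icc 1 n, F j ^ cycleCount σ j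

/-- The weight `ν_{n,d}(σ) = d(σ) / ∑_τ d(τ)` of `σ ∈ S_n`, where `d` is the multiplicative
function determined by `dhat`. -/
noncomputable def multMeasure (dhat : ℕ → ℝ) {n : ℕ} (σ : Equiv.Perm (Fin n)) : ℝ :=
  multFun dhat σ / ∑ τ : Equiv.Perm (Fin n), multFun dhat τ

/-- The weighted mean `M_n^d(f) = ∑_{σ ∈ S_n} f(σ) ν_{n,d}(σ)` of the multiplicative
function `f` determined by `fhat`. -/
noncomputable def weightedMean (dhat : ℕ → ℝ) (n : ℕ) (fhat : ℕ → ℂ) : ℂ :=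
  ∑ σ : Equiv.Perm (Fin n), multFun fhat σ * (multMeasure dhat σ : ℂ)

/-- `p_n = (1 / n!) ∑_{σ ∈ S_n} d(σ)`. -/
noncomputable def pCoeff (dhat : ℕ → ℝ) (n : ℕ) : ℝ :=
  (1 / (n.factorial : ℝ)) * ∑ σ : Equiv.Perm (Fin n), multFun dhat σ

/-- The formal power series `∑_{j ≥ 1} (d̂(j) / j) z ^ j`. -/
noncomputable def logSeries (dhat : ℕ → ℝ) : PowerSeries ℝ :=
  PowerSeries.mk fun j => if j = 0 then 0 else dhat j / (j : ℝ)

/-- The formal power series `exp {∑_{j ≥ 1} (d̂(j) / j) z ^ j}`: substitution of a series without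
constant term into the exponential series. -/
noncomputable def genSeries (dhat : ℕ → ℝ) : PowerSeries ℝ :=
  (PowerSeries.exp ℝ).subst (logSeries dhat)

/-- `Δ_n = |M_n^d(f) - exp {∑_{j ≤ n} d̂(j) (f̂(j) - 1) / j}|`. -/
noncomputable def meanError (dhat : ℕ → ℝ) (n : ℕ) (fhat : ℕ → ℂ) : ℝ :=
  ‖weightedMean dhat n fhat
    - Complex.exp (∑ j ∈ Icc 1 n, (dhat j : ℂ) * ((fhat j - 1) / (j : ℂ)))‖

/-!
The coefficient of `z ^ n` in `exp {∑ a(j) z ^ j / j}` is the sum over partitions of `n` given by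
the cycle index of `S_n`, so `M_n^d(f)` is a ratio of two such coefficients. Replace `f` by
`f_y(j) = 1 + (f(j) - 1) y ^ j`, which joins `1` to `f` as `y` runs from `0` to `1`, and let
`E_m(y)` be the coefficient of `z ^ m` for `d f_y`. The product
`E_n(y) exp {∑ d(l) (f(l) - 1) (1 - y ^ l) / l}` has a derivative in `y` that involves only the
differences `E_{n-l}(y) - E_n(y)`, and the recursion `n E_n = ∑ d(j) f_y(j) E_{n-j}` bounds these
by the `ℓ¹` norm of the coefficients of `(1 - z ^ l) exp {∑ d(j) f_y(j) z ^ j / j}` up to `z ^ n`.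

For `0 ≤ θ ≤ 1` with `θ ≤ d⁻`, split off the factor `exp {∑ θ (1 - y ^ j) z ^ j / j}`. Its
coefficients decrease, because `1 - θ + θ y ^ j` is log-convex in `j`, so multiplication by
`1 - z ^ l` leaves an `ℓ¹` norm of at most twice the sum of the first `l` of them; the remaining
factor is majorized by the series for `d(j) - θ + θ y ^ j`. Integrating over `y` with `θ = d⁻` and
with `θ = 1` gives the two bounds.
-/

open scoped PowerSeries

theorem sum_Icc_one_eq_sum_range {M : Type*} [AddCommMonoid M] (g : ℕ → M) (n : ℕ) :
    ∑ j ∈ Icc 1 n, g j = ∑ i ∈ range n, g (i + 1) := by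
  rw [← Ico_add_one_right_eq_Icc, sum_Ico_eq_sum_range]
  simp only [add_tsub_cancel_right, add_comm 1]

theorem sum_range_sub_eq_sum_Icc {M : Type*} [AddCommMonoid M] (g : ℕ → ℕ → M) (n : ℕ) :
    ∑ i ∈ range n, g (n - i) i = ∑ j ∈ Icc 1 n, g j (n - j) := by
  rw [sum_Icc_one_eq_sum_range, ← sum_range_reflect]
  refine sum_congr rfl fun i hi => ?_
  rw [mem_range] at hi
  congr 1 <;> omega

section TailSeries

variable {R : Type*} [CommSemiring R]

/-- The formal power series `∑_{j ≥ 1} a(j) z ^ j`. -/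
noncomputable def tailSeries (a : ℕ → R) : R⟦X⟧ :=
  PowerSeries.mk fun j => if j = 0 then 0 else a j

theorem coeff_tailSeries_mul (a : ℕ → R) (f : R⟦X⟧) (n : ℕ) :
    PowerSeries.coeff n (tailSeries a * f) =
      ∑ i ∈ range n, a (n - i) * PowerSeries.coeff i f := by
  rw [mul_comm, PowerSeries.coeff_mul, Nat.sum_antidiagonal_eq_sum_range_succ
    (fun i j => PowerSeries.coeff i f * PowerSeries.coeff j (tailSeries a)), sum_range_succ]
  simp only [tailSeries, PowerSeries.coeff_mk, tsub_self, if_true, mul_zero, add_zero]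
  refine sum_congr rfl fun i hi => ?_
  rw [if_neg (Nat.sub_ne_zero_of_lt (mem_range.1 hi)), mul_comm]

theorem tailSeries_add (a b : ℕ → R) : tailSeries (a + b) = tailSeries a + tailSeries b := by
  ext n
  by_cases hn : n = 0 <;> simp [tailSeries, hn]

theorem coeff_X_mul_derivative (f : R⟦X⟧) (n : ℕ) :
    PowerSeries.coeff n (PowerSeries.X * PowerSeries.derivative R f) =
      n * PowerSeries.coeff n f := by
  cases n with
  | zero => simp
  | succ n =>
    rw [PowerSeries.coeff_succ_X_mul, PowerSeries.coeff_derivative, mul_comm, Nat.cast_succ]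

end TailSeries

section ExpSeries

variable {K : Type*} [Field K]

/-- The formal power series `∑_{j ≥ 1} (a(j) / j) z ^ j`; its constant term is `a 0 / 0 = 0`. -/
noncomputable def primitiveSeries (a : ℕ → K) : K⟦X⟧ :=
  PowerSeries.mk fun j => a j / j

theorem constantCoeff_primitiveSeries (a : ℕ → K) :
    PowerSeries.constantCoeff (primitiveSeries a) = 0 := by
  simp [primitiveSeries]

theorem hasSubst_primitiveSeries (a : ℕ → K) : PowerSeries.HasSubst (primitiveSeries a) :=
  .of_constantCoeff_zero' (constantCoeff_primitiveSeries a)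

variable [CharZero K]

theorem X_mul_derivative_primitiveSeries (a : ℕ → K) :
    PowerSeries.X * PowerSeries.derivative K (primitiveSeries a) = tailSeries a := by
  ext n
  rw [coeff_X_mul_derivative]
  by_cases hn : n = 0 <;> simp [primitiveSeries, tailSeries, hn, mul_div_cancel₀]

/-- The formal power series `exp {∑_{j ≥ 1} (a(j) / j) z ^ j}`. -/
noncomputable def expSeries (a : ℕ → K) : K⟦X⟧ :=
  (PowerSeries.exp K).subst (primitiveSeries a)

/-- The coefficient of `z ^ n` in `exp {∑_{j ≥ 1} (a(j) / j) z ^ j}`. -/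
noncomputable def expCoeff (a : ℕ → K) (n : ℕ) : K :=
  PowerSeries.coeff n (expSeries a)

theorem constantCoeff_expSeries (a : ℕ → K) : PowerSeries.constantCoeff (expSeries a) = 1 := by
  have hsub : PowerSeries.constantCoeff
      ((PowerSeries.exp K - 1).subst (primitiveSeries a)) = 0 :=
    PowerSeries.constantCoeff_subst_eq_zero (constantCoeff_primitiveSeries a) _ (by simp)
  rw [← PowerSeries.coe_substAlgHom (hasSubst_primitiveSeries a), map_sub, map_one, map_sub,
    map_one, sub_eq_zero] at hsub
  rwa [expSeries, ← PowerSeries.coe_substAlgHom (hasSubst_primitiveSeries a)]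

theorem X_mul_derivative_expSeries (a : ℕ → K) :
    PowerSeries.X * PowerSeries.derivative K (expSeries a) = tailSeries a * expSeries a := by
  rw [expSeries, PowerSeries.derivative_subst (hasSubst_primitiveSeries a),
    PowerSeries.derivative_exp, mul_left_comm, X_mul_derivative_primitiveSeries, mul_comm]

theorem expCoeff_zero (a : ℕ → K) : expCoeff a 0 = 1 := by
  simpa [expCoeff] using constantCoeff_expSeries a

theorem natCast_mul_expCoeff (a : ℕ → K) (n : ℕ) :
    n * expCoeff a n = ∑ i ∈ range n, a (n - i) * expCoeff a i := by
  rw [expCoeff, ← coeff_X_mul_derivative, X_mul_derivative_expSeries, coeff_tailSeries_mul]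
  rfl

theorem expCoeff_one (a : ℕ → K) : expCoeff a 1 = a 1 := by
  simpa [expCoeff_zero] using natCast_mul_expCoeff a 1

theorem expCoeff_eq_of_recursion {a c : ℕ → K} {n : ℕ} (h_zero : c 0 = 1)
    (h_rec : ∀ m ≤ n, m * c m = ∑ i ∈ range m, a (m - i) * c i) : expCoeff a n = c n := by
  induction n using Nat.strong_induction_on with
  | _ n ih =>
    obtain rfl | hn := eq_or_ne n 0
    · rw [expCoeff_zero, h_zero]
    · refine mul_left_cancel₀ (Nat.cast_ne_zero.2 hn : (n : K) ≠ 0) ?_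
      rw [natCast_mul_expCoeff, h_rec n le_rfl]
      refine sum_congr rfl fun i hi => ?_
      have hin := mem_range.1 hi
      rw [ih i hin fun m hm => h_rec m (hm.trans hin.le)]

theorem expCoeff_congr {a b : ℕ → K} {n : ℕ} (h : ∀ j ∈ Icc 1 n, a j = b j) :
    expCoeff a n = expCoeff b n := by
  refine expCoeff_eq_of_recursion (expCoeff_zero b) fun m hm => ?_
  rw [natCast_mul_expCoeff]
  refine sum_congr rfl fun i hi => ?_
  rw [mem_range] at hi
  rw [h (m - i) (mem_Icc.2 ⟨by omega, by omega⟩)]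

theorem eq_expSeries {a : ℕ → K} {f : K⟦X⟧} (h_zero : PowerSeries.constantCoeff f = 1)
    (h_deriv : PowerSeries.X * PowerSeries.derivative K f = tailSeries a * f) :
    f = expSeries a := by
  ext n
  refine (expCoeff_eq_of_recursion (c := fun n => PowerSeries.coeff n f) (by simpa using h_zero)
    fun m _ => ?_).symm
  rw [← coeff_X_mul_derivative, h_deriv, coeff_tailSeries_mul]

theorem expSeries_add (a b : ℕ → K) : expSeries (a + b) = expSeries a * expSeries b := by
  refine (eq_expSeries ?_ ?_).symm
  · rw [map_mul, constantCoeff_expSeries, constantCoeff_expSeries, one_mul]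
  · rw [tailSeries_add, Derivation.leibniz, smul_eq_mul, smul_eq_mul, mul_add]
    linear_combination expSeries a * X_mul_derivative_expSeries b +
      expSeries b * X_mul_derivative_expSeries a

theorem expCoeff_add (a b : ℕ → K) (n : ℕ) :
    expCoeff (a + b) n = ∑ i ∈ range (n + 1), expCoeff a i * expCoeff b (n - i) := by
  rw [expCoeff, expSeries_add, PowerSeries.coeff_mul]
  exact Nat.sum_antidiagonal_eq_sum_range_succ (fun i j => expCoeff a i * expCoeff b j) n

theorem expCoeff_const_one (n : ℕ) : expCoeff (1 : ℕ → K) n = 1 :=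
  expCoeff_eq_of_recursion (c := 1) rfl fun m _ => by simp

theorem expCoeff_add_one (a : ℕ → K) (n : ℕ) :
    expCoeff (a + 1) n = ∑ i ∈ range (n + 1), expCoeff a i := by
  simp only [expCoeff_add, expCoeff_const_one, mul_one]

theorem expCoeff_mul_pow (a : ℕ → K) (y : K) (n : ℕ) :
    expCoeff (fun j => a j * y ^ j) n = expCoeff a n * y ^ n := by
  refine expCoeff_eq_of_recursion (c := fun n => expCoeff a n * y ^ n) (by simp [expCoeff_zero])
    fun m _ => ?_
  rw [← mul_assoc, natCast_mul_expCoeff, sum_mul]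
  refine sum_congr rfl fun i hi => ?_
  rw [← pow_sub_mul_pow y (mem_range.1 hi).le]
  ring

theorem map_expCoeff {F : Type*} [Field F] [CharZero F] (φ : K →+* F) (a : ℕ → K) (n : ℕ) :
    φ (expCoeff a n) = expCoeff (fun j => φ (a j)) n := by
  refine (expCoeff_eq_of_recursion (c := fun n => φ (expCoeff a n)) (by simp [expCoeff_zero])
    fun m _ => ?_).symm
  simp only [← map_natCast φ, ← map_mul, natCast_mul_expCoeff, map_sum]

theorem map_expSeries {F : Type*} [Field F] [CharZero F] (φ : K →+* F) (a : ℕ → K) :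
    PowerSeries.map φ (expSeries a) = expSeries fun j => φ (a j) := by
  ext n
  rw [PowerSeries.coeff_map]
  exact map_expCoeff φ a n

end ExpSeries

theorem genSeries_eq_expSeries (a : ℕ → ℝ) : genSeries a = expSeries a := by
  have hlog : logSeries a = primitiveSeries a := by
    ext j
    by_cases hj : j = 0 <;> simp [logSeries, primitiveSeries, hj]
  rw [genSeries, hlog, expSeries]

section Majorant

theorem expCoeff_nonneg {K : Type*} [Field K] [LinearOrder K] [IsStrictOrderedRing K]
    {a : ℕ → K} (ha : ∀ j, 0 ≤ a j) (n : ℕ) : 0 ≤ expCoeff a n := by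
  induction n using Nat.strong_induction_on with
  | _ n ih =>
    obtain rfl | hn := Nat.eq_zero_or_pos n
    · rw [expCoeff_zero]
      exact zero_le_one
    · refine nonneg_of_mul_nonneg_right ?_ (Nat.cast_pos.2 hn : (0 : K) < n)
      rw [natCast_mul_expCoeff]
      exact sum_nonneg fun i hi => mul_nonneg (ha _) (ih i (mem_range.1 hi))

theorem expCoeff_pos {K : Type*} [Field K] [LinearOrder K] [IsStrictOrderedRing K]
    {a : ℕ → K} (ha : ∀ j, 0 < a j) (n : ℕ) : 0 < expCoeff a n := by
  obtain rfl | hn := Nat.eq_zero_or_pos n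
  · rw [expCoeff_zero]
    exact zero_lt_one
  · refine pos_of_mul_pos_right ?_ (Nat.cast_nonneg n : (0 : K) ≤ n)
    rw [natCast_mul_expCoeff]
    refine sum_pos' (fun i _ => mul_nonneg (ha _).le (expCoeff_nonneg (fun j => (ha j).le) i))
      ⟨0, mem_range.2 hn, ?_⟩
    rw [expCoeff_zero, mul_one]
    exact ha _

theorem norm_expCoeff_le {𝕜 : Type*} [RCLike 𝕜] {a : ℕ → 𝕜} {b : ℕ → ℝ}
    (hab : ∀ j, ‖a j‖ ≤ b j) (n : ℕ) : ‖expCoeff a n‖ ≤ expCoeff b n := by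
  induction n using Nat.strong_induction_on with
  | _ n ih =>
    obtain rfl | hn := Nat.eq_zero_or_pos n
    · simp [expCoeff_zero]
    · refine le_of_mul_le_mul_left ?_ (Nat.cast_pos.2 hn : (0 : ℝ) < n)
      calc n * ‖expCoeff a n‖ = ‖∑ i ∈ range n, a (n - i) * expCoeff a i‖ := by
            rw [← natCast_mul_expCoeff, norm_mul, RCLike.norm_natCast]
        _ ≤ ∑ i ∈ range n, ‖a (n - i)‖ * ‖expCoeff a i‖ := norm_sum_le_of_le _ fun i _ =>
            norm_mul_le _ _
        _ ≤ ∑ i ∈ range n, b (n - i) * expCoeff b i := by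
            gcongr with i hi
            · exact (norm_nonneg _).trans (hab _)
            · exact hab _
            · exact ih i (mem_range.1 hi)
        _ = n * expCoeff b n := (natCast_mul_expCoeff b n).symm

end Majorant

section CycleIndex

variable {K : Type*} [Field K]

/-- The weight `∏_j (a(j) / j) ^ m_j / m_j!` of a multiset containing `j` with multiplicity
`m_j`: the contribution of one cycle type to the cycle index. -/
noncomputable def cycleWeight (a : ℕ → K) (s : Multiset ℕ) : K :=
  ∏ j ∈ s.toFinset, (a j / j) ^ s.count j / (s.count j).factorial

theorem cycleWeight_eq_prod (a : ℕ → K) {s : Multiset ℕ} {T : Finset ℕ} (h : s.toFinset ⊆ T) :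
    cycleWeight a s = ∏ j ∈ T, (a j / j) ^ s.count j / (s.count j).factorial := by
  refine prod_subset h fun j _ hj => ?_
  rw [Multiset.mem_toFinset] at hj
  simp [Multiset.count_eq_zero_of_notMem hj]

theorem count_mul_cycleWeight_cons [CharZero K] (a : ℕ → K) (s : Multiset ℕ) {j : ℕ}
    (hj : j ≠ 0) :
    ((j ::ₘ s).count j * j : ℕ) * cycleWeight a (j ::ₘ s) = a j * cycleWeight a s := by
  have hj' : (j : K) ≠ 0 := Nat.cast_ne_zero.2 hj
  have hcount : ((s.count j : ℕ) + 1 : K) ≠ 0 := Nat.cast_add_one_ne_zero _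
  have hfac : ((s.count j).factorial : K) ≠ 0 := Nat.cast_ne_zero.2 (Nat.factorial_ne_zero _)
  have hmem : j ∈ (j ::ₘ s).toFinset := by simp
  rw [cycleWeight, cycleWeight_eq_prod a (s.toFinset_subset.2 (s.subset_cons j)),
    ← mul_prod_erase _ _ hmem, ← mul_prod_erase (j ::ₘ s).toFinset (fun i =>
      (a i / (i : K)) ^ s.count i / ((s.count i).factorial : K)) hmem,
    prod_congr rfl fun i hi => by rw [Multiset.count_cons_of_ne (ne_of_mem_erase hi)],
    Multiset.count_cons_self, Nat.factorial_succ, pow_succ]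
  push_cast
  field_simp

theorem sum_partition_count_mul [CharZero K] (a : ℕ → K) {n j : ℕ} (hj : j ∈ Icc 1 n) :
    ∑ l : n.Partition, (l.parts.count j * j : ℕ) * cycleWeight a l.parts =
      a j * ∑ l : (n - j).Partition, cycleWeight a l.parts := by
  obtain ⟨hj₁, hjn⟩ := mem_Icc.1 hj
  have hsupport : ∀ l : n.Partition, ((l.parts.count j * j : ℕ) : K) * cycleWeight a l.parts ≠ 0 →
      j ∈ l.parts := by
    intro l hl
    by_contra hmem
    simp [Multiset.count_eq_zero_of_notMem hmem] at hl
  rw [mul_sum, ← sum_filter_of_ne fun l _ => hsupport l,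
    sum_subtype _ (p := fun l : n.Partition => j ∈ l.parts) (by simp),
    ← (Nat.Partition.partitionWithPartEquiv hj₁ hjn).symm.sum_comp]
  simp only [Nat.Partition.partitionWithPartEquiv_symm_apply_parts,
    count_mul_cycleWeight_cons a _ (Nat.one_le_iff_ne_zero.1 hj₁)]

theorem toFinset_parts_subset_Icc {n : ℕ} (l : n.Partition) : l.parts.toFinset ⊆ Icc 1 n :=
  fun _ hj => mem_Icc.2 ⟨l.parts_pos (Multiset.mem_toFinset.1 hj),
    Nat.Partition.le_of_mem_parts (Multiset.mem_toFinset.1 hj)⟩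

theorem sum_Icc_count_mul {n : ℕ} (l : n.Partition) : ∑ j ∈ Icc 1 n, l.parts.count j * j = n := by
  conv_rhs => rw [← l.parts_sum, sum_multiset_count_of_subset _ _ (toFinset_parts_subset_Icc l)]
  simp only [smul_eq_mul]

theorem sum_partition_cycleWeight [CharZero K] (a : ℕ → K) (n : ℕ) :
    ∑ l : n.Partition, cycleWeight a l.parts = expCoeff a n := by
  refine (expCoeff_eq_of_recursion
    (c := fun n => ∑ l : n.Partition, cycleWeight a l.parts) (by simp [cycleWeight])
    fun m _ => ?_).symm
  rw [sum_range_sub_eq_sum_Icc fun j i => a j * ∑ l : i.Partition, cycleWeight a l.parts,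
    ← sum_congr rfl fun j hj => sum_partition_count_mul a hj, sum_comm, mul_sum]
  refine sum_congr rfl fun l _ => ?_
  rw [← sum_mul, ← Nat.cast_sum, sum_Icc_count_mul]

theorem filter_two_le_add_replicate {n : ℕ} (l : n.Partition) :
    l.parts.filter (2 ≤ ·) + Multiset.replicate (l.parts.count 1) 1 = l.parts := by
  rw [← Multiset.filter_eq']
  conv_rhs => rw [← Multiset.filter_add_not (2 ≤ ·) l.parts]
  congr 1
  refine Multiset.filter_congr fun j hj => ?_
  have := l.parts_pos hj
  omega

theorem sum_filter_two_le_add_count_one {n : ℕ} (l : n.Partition) :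
    (l.parts.filter (2 ≤ ·)).sum + l.parts.count 1 = n := by
  conv_rhs => rw [← l.parts_sum, ← filter_two_le_add_replicate l]
  rw [Multiset.sum_add, Multiset.sum_replicate, smul_eq_mul, mul_one]

theorem prod_filter_two_le {n : ℕ} (l : n.Partition) :
    (l.parts.filter (2 ≤ ·)).prod = l.parts.prod := by
  conv_rhs => rw [← filter_two_le_add_replicate l]
  rw [Multiset.prod_add, Multiset.prod_replicate, one_pow, mul_one]

theorem prod_factorial_count_eq {n : ℕ} (l : n.Partition) :
    ∏ j ∈ l.parts.toFinset, (l.parts.count j).factorial =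
      (l.parts.count 1).factorial * ∏ j ∈ (l.parts.filter (2 ≤ ·)).toFinset,
        ((l.parts.filter (2 ≤ ·)).count j).factorial := by
  have hsub : l.parts.toFinset ⊆ insert 1 (l.parts.filter (2 ≤ ·)).toFinset := by
    intro j hj
    rw [Multiset.mem_toFinset] at hj
    have hpos := l.parts_pos hj
    rw [mem_insert, Multiset.mem_toFinset, Multiset.mem_filter]
    exact (eq_or_ne j 1).imp_right fun hj₁ => ⟨hj, by omega⟩
  rw [prod_subset hsub fun j _ hj => ?_, prod_insert (by simp)]
  · congr 1
    refine prod_congr rfl fun j hj => ?_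
    rw [Multiset.mem_toFinset, Multiset.mem_filter] at hj
    rw [Multiset.count_filter, if_pos hj.2]
  · rw [Multiset.mem_toFinset] at hj
    simp [Multiset.count_eq_zero_of_notMem hj]

variable {α : Type*} [Fintype α] [DecidableEq α]

theorem partition_eq_iff_cycleType_eq (σ : Equiv.Perm α) (l : (Fintype.card α).Partition) :
    σ.partition = l ↔ σ.cycleType = l.parts.filter (2 ≤ ·) := by
  rw [← Equiv.Perm.filter_parts_partition_eq_cycleType]
  refine ⟨fun h => h ▸ rfl, fun h => Nat.Partition.ext ?_⟩
  have hcount : σ.partition.parts.count 1 = l.parts.count 1 := by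
    have hsum := sum_filter_two_le_add_count_one σ.partition
    rw [h] at hsum
    exact Nat.add_left_cancel (hsum.trans (sum_filter_two_le_add_count_one l).symm)
  rw [← filter_two_le_add_replicate σ.partition, h, hcount, filter_two_le_add_replicate]

theorem card_filter_partition_eq_mul (l : (Fintype.card α).Partition) :
    #{σ : Equiv.Perm α | σ.partition = l} *
      (l.parts.prod * ∏ j ∈ l.parts.toFinset, (l.parts.count j).factorial) =
        (Fintype.card α).factorial := by
  have hsum := sum_filter_two_le_add_count_one l
  have hcard := Equiv.Perm.card_of_cycleType_mul_eq α (l.parts.filter (2 ≤ ·))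
  rw [if_pos ⟨by omega, fun i hi => (Multiset.mem_filter.1 hi).2⟩, prod_filter_two_le,
    Nat.sub_eq_of_eq_add' hsum.symm] at hcard
  simp only [partition_eq_iff_cycleType_eq, prod_factorial_count_eq, ← hcard]
  ring

theorem card_filter_partition_eq_mul_prod_pow [CharZero K] (a : ℕ → K)
    (l : (Fintype.card α).Partition) :
    #{σ : Equiv.Perm α | σ.partition = l} * ∏ j ∈ l.parts.toFinset, a j ^ l.parts.count j =
      (Fintype.card α).factorial * cycleWeight a l.parts := by
  have hparts : ∏ j ∈ l.parts.toFinset, (j : K) ^ l.parts.count j ≠ 0 :=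
    prod_ne_zero_iff.2 fun j hj => pow_ne_zero _
      (Nat.cast_ne_zero.2 (l.parts_pos (Multiset.mem_toFinset.1 hj)).ne')
  have hfac : ∏ j ∈ l.parts.toFinset, ((l.parts.count j).factorial : K) ≠ 0 :=
    prod_ne_zero_iff.2 fun j _ => Nat.cast_ne_zero.2 (Nat.factorial_ne_zero _)
  rw [← card_filter_partition_eq_mul l, prod_multiset_count, cycleWeight]
  simp only [prod_div_distrib, div_pow]
  push_cast
  field_simp

theorem sum_perm_prod_pow_count [CharZero K] (a : ℕ → K) :
    ∑ σ : Equiv.Perm α, ∏ j ∈ Icc 1 (Fintype.card α), a j ^ σ.partition.parts.count j =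
      (Fintype.card α).factorial * expCoeff a (Fintype.card α) := by
  rw [← sum_partition_cycleWeight, mul_sum, ← sum_fiberwise univ fun σ => σ.partition]
  refine sum_congr rfl fun l _ => ?_
  rw [sum_congr rfl fun σ hσ => by rw [(mem_filter.1 hσ).2], sum_const, nsmul_eq_mul,
    ← card_filter_partition_eq_mul_prod_pow, prod_subset (toFinset_parts_subset_Icc l)]
  intro j _ hj
  rw [Multiset.mem_toFinset] at hj
  rw [Multiset.count_eq_zero_of_notMem hj, pow_zero]

theorem sum_multFun [CharZero K] (a : ℕ → K) (n : ℕ) :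
    ∑ σ : Equiv.Perm (Fin n), multFun a σ = n.factorial * expCoeff a n := by
  have h := sum_perm_prod_pow_count (α := Fin n) a
  simp only [Fintype.card_fin] at h
  exact h

end CycleIndex

theorem pCoeff_eq_expCoeff (a : ℕ → ℝ) (n : ℕ) : pCoeff a n = expCoeff a n := by
  rw [pCoeff, sum_multFun, one_div, inv_mul_cancel_left₀ (Nat.cast_ne_zero.2 n.factorial_ne_zero)]

theorem pCoeff_eq_coeff_genSeries (a : ℕ → ℝ) (n : ℕ) :
    pCoeff a n = PowerSeries.coeff n (genSeries a) := by
  rw [pCoeff_eq_expCoeff, genSeries_eq_expSeries, expCoeff]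

theorem weightedMean_eq_div (d : ℕ → ℝ) (n : ℕ) (f : ℕ → ℂ) :
    weightedMean d n f = expCoeff (fun j => d j * f j) n / (expCoeff d n : ℝ) := by
  have hsummand : ∀ σ : Equiv.Perm (Fin n), multFun f σ * (multMeasure d σ : ℂ) =
      multFun (fun j => d j * f j) σ / (∑ τ : Equiv.Perm (Fin n), multFun d τ : ℝ) := by
    intro σ
    simp only [multFun, multMeasure, mul_pow, prod_mul_distrib]
    push_cast
    ring
  rw [weightedMean, sum_congr rfl fun σ _ => hsummand σ, ← sum_div, sum_multFun, sum_multFun,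
    Complex.ofReal_mul, Complex.ofReal_natCast,
    mul_div_mul_left _ _ (Nat.cast_ne_zero.2 n.factorial_ne_zero)]

section TruncNorm

/-- The sum of the norms of the coefficients of index at most `n`: a submultiplicative seminorm on
power series. -/
noncomputable def truncNorm {R : Type*} [NormedRing R] (n : ℕ) (f : R⟦X⟧) : ℝ :=
  ∑ i ∈ range (n + 1), ‖PowerSeries.coeff i f‖

variable {R : Type*} [NormedRing R]

theorem truncNorm_nonneg (n : ℕ) (f : R⟦X⟧) : 0 ≤ truncNorm n f :=
  sum_nonneg fun _ _ => norm_nonneg _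

theorem truncNorm_mul_le (n : ℕ) (f g : R⟦X⟧) :
    truncNorm n (f * g) ≤ truncNorm n f * truncNorm n g := by
  calc truncNorm n (f * g)
      ≤ ∑ m ∈ range (n + 1), ∑ i ∈ range (m + 1),
          ‖PowerSeries.coeff i f‖ * ‖PowerSeries.coeff (m - i) g‖ := by
        refine sum_le_sum fun m _ => ?_
        rw [PowerSeries.coeff_mul, Nat.sum_antidiagonal_eq_sum_range_succ
          (fun i j => PowerSeries.coeff i f * PowerSeries.coeff j g)]
        exact norm_sum_le_of_le _ fun i _ => norm_mul_le _ _
    _ = ∑ i ∈ range (n + 1), ∑ m ∈ range (n + 1 - i),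
          ‖PowerSeries.coeff i f‖ * ‖PowerSeries.coeff m g‖ :=
        sum_range_diag_flip (n + 1) fun i m => ‖PowerSeries.coeff i f‖ * ‖PowerSeries.coeff m g‖
    _ ≤ ∑ i ∈ range (n + 1), ∑ m ∈ range (n + 1),
          ‖PowerSeries.coeff i f‖ * ‖PowerSeries.coeff m g‖ := by
        gcongr with i
        exact Nat.sub_le _ _
    _ = truncNorm n f * truncNorm n g := by rw [truncNorm, truncNorm, sum_mul_sum]

theorem truncNorm_pow_le [NormOneClass R] (n k : ℕ) (f : R⟦X⟧) :
    truncNorm n (f ^ k) ≤ truncNorm n f ^ k := by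
  induction k with
  | zero => simp [truncNorm, sum_range_succ', PowerSeries.coeff_one]
  | succ k ih =>
    rw [pow_succ, pow_succ]
    exact (truncNorm_mul_le n _ f).trans (mul_le_mul_of_nonneg_right ih (truncNorm_nonneg n f))

theorem truncNorm_map {S : Type*} [NormedRing S] {φ : R →+* S} (hφ : ∀ x, ‖φ x‖ = ‖x‖) (n : ℕ)
    (f : R⟦X⟧) : truncNorm n (PowerSeries.map φ f) = truncNorm n f := by
  simp only [truncNorm, PowerSeries.coeff_map, hφ]

theorem truncNorm_eq_sum_coeff {f : ℝ⟦X⟧} (hf : ∀ i, 0 ≤ PowerSeries.coeff i f) (n : ℕ) :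
    truncNorm n f = ∑ i ∈ range (n + 1), PowerSeries.coeff i f :=
  sum_congr rfl fun i _ => Real.norm_of_nonneg (hf i)

end TruncNorm

section ExpBound

theorem coeff_subst_eq_sum {R : Type*} [CommRing R] (f : R⟦X⟧) {g : R⟦X⟧}
    (hg : PowerSeries.constantCoeff g = 0) {i n : ℕ} (hin : i ≤ n) :
    PowerSeries.coeff i (f.subst g) =
      ∑ k ∈ range (n + 1), PowerSeries.coeff k f * PowerSeries.coeff i (g ^ k) := by
  rw [PowerSeries.coeff_subst' (.of_constantCoeff_zero' hg),
    finsum_eq_sum_of_support_subset (s := range (n + 1))]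
  · simp only [smul_eq_mul]
  · refine Function.support_subset_iff'.2 fun k hk => ?_
    have hik : i < k := by simpa using hin.trans_lt (by simpa using hk)
    rw [PowerSeries.X_pow_dvd_iff.1 (pow_dvd_pow_of_dvd (PowerSeries.X_dvd_iff.2 hg) k) i hik,
      smul_zero]

theorem truncNorm_exp_subst_le {𝕜 : Type*} [RCLike 𝕜] {g : 𝕜⟦X⟧}
    (hg : PowerSeries.constantCoeff g = 0) (n : ℕ) :
    truncNorm n ((PowerSeries.exp 𝕜).subst g) ≤ Real.exp (truncNorm n g) := by
  have hexp : ∀ k : ℕ, ‖PowerSeries.coeff k (PowerSeries.exp 𝕜)‖ = (k.factorial : ℝ)⁻¹ := by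
    intro k
    simp [PowerSeries.coeff_exp]
  calc truncNorm n ((PowerSeries.exp 𝕜).subst g)
      ≤ ∑ i ∈ range (n + 1), ∑ k ∈ range (n + 1),
          (k.factorial : ℝ)⁻¹ * ‖PowerSeries.coeff i (g ^ k)‖ := by
        refine sum_le_sum fun i hi => ?_
        rw [coeff_subst_eq_sum _ hg (Nat.lt_succ_iff.1 (mem_range.1 hi))]
        exact norm_sum_le_of_le _ fun k _ => by rw [norm_mul, hexp]
    _ = ∑ k ∈ range (n + 1), (k.factorial : ℝ)⁻¹ * truncNorm n (g ^ k) := by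
        rw [sum_comm]
        simp only [truncNorm, mul_sum]
    _ ≤ ∑ k ∈ range (n + 1), truncNorm n g ^ k / k.factorial := by
        refine sum_le_sum fun k _ => ?_
        rw [inv_mul_eq_div]
        gcongr
        exact truncNorm_pow_le n k g
    _ ≤ Real.exp (truncNorm n g) := Real.sum_le_exp_of_nonneg (truncNorm_nonneg n g) _

theorem truncNorm_expSeries_eq_sum {a : ℕ → ℝ} (ha : ∀ j, 0 ≤ a j) (n : ℕ) :
    truncNorm n (expSeries a) = ∑ i ∈ range (n + 1), expCoeff a i :=
  truncNorm_eq_sum_coeff (expCoeff_nonneg ha) n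

theorem truncNorm_expSeries_le {𝕜 : Type*} [RCLike 𝕜] {u : ℕ → 𝕜} {b : ℕ → ℝ}
    (hub : ∀ j, ‖u j‖ ≤ b j) (n : ℕ) :
    truncNorm n (expSeries u) ≤ ∑ i ∈ range (n + 1), expCoeff b i :=
  sum_le_sum fun i _ => norm_expCoeff_le hub i

theorem truncNorm_primitiveSeries {a : ℕ → ℝ} (ha : ∀ j, 0 ≤ a j) (n : ℕ) :
    truncNorm n (primitiveSeries a) = ∑ j ∈ Icc 1 n, a j / j := by
  rw [truncNorm_eq_sum_coeff fun j => by
      rw [primitiveSeries, PowerSeries.coeff_mk]; exact div_nonneg (ha j) j.cast_nonneg,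
    sum_Icc_one_eq_sum_range, sum_range_succ']
  simp [primitiveSeries]

theorem sum_expCoeff_le_exp {a : ℕ → ℝ} (ha : ∀ j, 0 ≤ a j) (n : ℕ) :
    ∑ i ∈ range (n + 1), expCoeff a i ≤ Real.exp (∑ j ∈ Icc 1 n, a j / j) := by
  rw [← truncNorm_expSeries_eq_sum ha, ← truncNorm_primitiveSeries ha]
  exact truncNorm_exp_subst_le (constantCoeff_primitiveSeries a) n

theorem sum_expCoeff_add_le_mul_exp {b c : ℕ → ℝ} (hb : ∀ j, 0 ≤ b j) (hc : ∀ j, 0 ≤ c j)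
    (n : ℕ) :
    ∑ i ∈ range (n + 1), expCoeff (b + c) i ≤
      (∑ i ∈ range (n + 1), expCoeff b i) * Real.exp (∑ j ∈ Icc 1 n, c j / j) := by
  calc ∑ i ∈ range (n + 1), expCoeff (b + c) i
      = truncNorm n (expSeries b * expSeries c) := by
        rw [← expSeries_add, truncNorm_expSeries_eq_sum (a := b + c) fun j =>
          add_nonneg (hb j) (hc j)]
    _ ≤ truncNorm n (expSeries b) * truncNorm n (expSeries c) := truncNorm_mul_le n _ _
    _ ≤ _ := by
        rw [truncNorm_expSeries_eq_sum hb, truncNorm_expSeries_eq_sum hc]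
        gcongr
        · exact sum_nonneg fun i _ => expCoeff_nonneg hb i
        · exact sum_expCoeff_le_exp hc n

end ExpBound

section Kaluza

theorem mul_succ_mul_expCoeff_succ {K : Type*} [Field K] [CharZero K] (a : ℕ → K) (i : ℕ) :
    a i * ((i + 1) * expCoeff a (i + 1)) =
      (a i * a 1 + i * a (i + 1)) * expCoeff a i +
        ∑ j ∈ range i, (a i * a (i - j + 1) - a (i + 1) * a (i - j)) * expCoeff a j := by
  have hi := natCast_mul_expCoeff a i
  have hsucc := natCast_mul_expCoeff a (i + 1)
  rw [sum_range_succ, Nat.add_sub_cancel_left,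
    sum_congr rfl fun j hj => by rw [Nat.sub_add_comm (mem_range.1 hj).le]] at hsucc
  have hsum : ∑ j ∈ range i, (a i * a (i - j + 1) - a (i + 1) * a (i - j)) * expCoeff a j =
      a i * ∑ j ∈ range i, a (i - j + 1) * expCoeff a j -
        a (i + 1) * ∑ j ∈ range i, a (i - j) * expCoeff a j := by
    simp only [mul_sum, ← sum_sub_distrib, sub_mul, mul_assoc]
  push_cast at hsucc
  linear_combination a i * hsucc - a (i + 1) * hi - hsum

variable {K : Type*} [Field K] [LinearOrder K] [IsStrictOrderedRing K]

-- The counterpart for `exp` of Kaluza's theorem on reciprocals of series with log-convex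
-- coefficients.
theorem expCoeff_neg_succ_nonpos {e : ℕ → K} (h_zero : e 0 ≤ 1) (h_pos : ∀ j, 0 < e j)
    (h_ratio : Monotone fun j => e (j + 1) / e j) (n : ℕ) : expCoeff (-e) (n + 1) ≤ 0 := by
  have hcross : ∀ {i j}, j ≤ i → e i * e (j + 1) ≤ e (i + 1) * e j := fun {i j} hji => by
    rw [mul_comm]
    exact (div_le_div_iff₀ (h_pos j) (h_pos i)).1 (h_ratio hji)
  induction n using Nat.strong_induction_on with
  | _ i ih =>
    obtain rfl | hi := Nat.eq_zero_or_pos i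
    · simpa [expCoeff_one] using (h_pos 1).le
    have hlead : 0 ≤ (e i * e 1 - i * e (i + 1)) * expCoeff (-e) i := by
      refine mul_nonneg_of_nonpos_of_nonpos (sub_nonpos.2 ?_) ?_
      · calc e i * e 1 ≤ e (i + 1) * e 0 := hcross i.zero_le
          _ ≤ e (i + 1) := mul_le_of_le_one_right (h_pos _).le h_zero
          _ ≤ i * e (i + 1) := le_mul_of_one_le_left (h_pos _).le (Nat.one_le_cast.2 hi)
      · exact Nat.sub_add_cancel hi ▸ ih (i - 1) (Nat.sub_lt hi one_pos)
    have hsum : 0 ≤ ∑ j ∈ range i,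
        (e i * e (i - j + 1) - e (i + 1) * e (i - j)) * expCoeff (-e) j := by
      refine sum_nonneg fun j hj => ?_
      obtain _ | j := j
      · simp [mul_comm]
      · exact mul_nonneg_of_nonpos_of_nonpos (sub_nonpos.2 (hcross (Nat.sub_le _ _)))
          (ih j (Nat.lt_of_succ_lt (mem_range.1 hj)))
    have hid := mul_succ_mul_expCoeff_succ (-e) i
    simp only [Pi.neg_apply, neg_mul, mul_neg, neg_neg] at hid
    refine nonpos_of_mul_nonpos_right (a := e i * (i + 1)) ?_ (mul_pos (h_pos i) (by positivity))
    linarith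

theorem antitone_expCoeff_one_sub {e : ℕ → K} (h_zero : e 0 ≤ 1) (h_pos : ∀ j, 0 < e j)
    (h_ratio : Monotone fun j => e (j + 1) / e j) : Antitone (expCoeff (1 - e)) := by
  refine antitone_nat_of_succ_le fun n => ?_
  rw [sub_eq_neg_add, expCoeff_add_one, expCoeff_add_one, sum_range_succ _ (n + 1)]
  exact add_le_of_nonpos_right (expCoeff_neg_succ_nonpos h_zero h_pos h_ratio n)

theorem antitone_expCoeff_mul_one_sub_pow {θ y : K} (hθ₀ : 0 ≤ θ) (hθ₁ : θ ≤ 1) (hy : 0 < y) :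
    Antitone (expCoeff fun j => θ * (1 - y ^ j)) := by
  have hpos : ∀ j, 0 < 1 - θ + θ * y ^ j := fun j => by
    obtain rfl | hθ := hθ₀.eq_or_lt
    · simp
    · exact add_pos_of_nonneg_of_pos (sub_nonneg.2 hθ₁) (mul_pos hθ (pow_pos hy j))
  have hratio : Monotone fun j => (1 - θ + θ * y ^ (j + 1)) / (1 - θ + θ * y ^ j) := by
    refine monotone_nat_of_le_succ fun j => ?_
    rw [div_le_div_iff₀ (hpos _) (hpos _)]
    have : 0 ≤ (1 - θ) * θ * y ^ j * (1 - y) ^ 2 :=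
      mul_nonneg (mul_nonneg (mul_nonneg (sub_nonneg.2 hθ₁) hθ₀) (pow_pos hy j).le) (sq_nonneg _)
    simp only [pow_succ]
    linarith
  convert antitone_expCoeff_one_sub (by simp) hpos hratio using 2
  ext j
  simp only [Pi.sub_apply, Pi.one_apply]
  ring

end Kaluza

section Variation

theorem coeff_one_sub_X_pow_mul {R : Type*} [Ring R] (f : R⟦X⟧) (l i : ℕ) :
    PowerSeries.coeff i ((1 - PowerSeries.X ^ l) * f) =
      PowerSeries.coeff i f - if l ≤ i then PowerSeries.coeff (i - l) f else 0 := by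
  rw [sub_mul, one_mul, map_sub, PowerSeries.coeff_X_pow_mul']

theorem truncNorm_one_sub_X_pow_mul_le_of_antitone {f : ℝ⟦X⟧}
    (h_anti : Antitone fun i => PowerSeries.coeff i f) (h_nonneg : ∀ i, 0 ≤ PowerSeries.coeff i f)
    (l n : ℕ) :
    truncNorm n ((1 - PowerSeries.X ^ l) * f) ≤ 2 * ∑ i ∈ range l, PowerSeries.coeff i f := by
  have hinit : ∀ i ∈ range l, ‖PowerSeries.coeff i ((1 - PowerSeries.X ^ l) * f)‖ =
      PowerSeries.coeff i f := fun i hi => by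
    rw [coeff_one_sub_X_pow_mul, if_neg (not_le.2 (mem_range.1 hi)), sub_zero,
      Real.norm_of_nonneg (h_nonneg i)]
  have htail : ∀ i, ‖PowerSeries.coeff (l + i) ((1 - PowerSeries.X ^ l) * f)‖ =
      PowerSeries.coeff i f - PowerSeries.coeff (l + i) f := fun i => by
    rw [coeff_one_sub_X_pow_mul, if_pos le_self_add, Nat.add_sub_cancel_left, norm_sub_rev,
      Real.norm_of_nonneg (sub_nonneg.2 (h_anti le_add_self))]
  have hmono : ∑ i ∈ range (n + 1), PowerSeries.coeff i f ≤
      ∑ i ∈ range (l + (n + 1)), PowerSeries.coeff i f :=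
    sum_le_sum_of_subset_of_nonneg (range_mono le_add_self) fun i _ _ => h_nonneg i
  calc truncNorm n ((1 - PowerSeries.X ^ l) * f)
      ≤ ∑ i ∈ range (l + (n + 1)), ‖PowerSeries.coeff i ((1 - PowerSeries.X ^ l) * f)‖ :=
        sum_le_sum_of_subset_of_nonneg (range_mono le_add_self) fun _ _ _ => norm_nonneg _
    _ = ∑ i ∈ range l, PowerSeries.coeff i f + ∑ i ∈ range (n + 1),
          (PowerSeries.coeff i f - PowerSeries.coeff (l + i) f) := by
        rw [sum_range_add, sum_congr rfl hinit, sum_congr rfl fun i _ => htail i]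
    _ ≤ 2 * ∑ i ∈ range l, PowerSeries.coeff i f := by
        rw [sum_range_add _ l] at hmono
        rw [sum_sub_distrib]
        linarith

/-- The exponent `∑_{j < l} (1 - y ^ j) / j + ∑_{j ≤ n} y ^ j / j` controlling the total variation
`truncNorm n ((1 - X ^ l) * expSeries u)` when `u` is close to `θ (1 - y ^ j)`. -/
noncomputable def variationExponent (n l : ℕ) (y : ℝ) : ℝ :=
  ∑ j ∈ Icc 1 (l - 1), (1 - y ^ j) / j + ∑ j ∈ Icc 1 n, y ^ j / j

variable {𝕜 : Type*} [RCLike 𝕜] {θ y : ℝ}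

theorem truncNorm_one_sub_X_pow_mul_expSeries_mul_one_sub_pow_le (hθ₀ : 0 ≤ θ) (hθ₁ : θ ≤ 1)
    (hy₀ : 0 < y) (hy₁ : y ≤ 1) {l : ℕ} (hl : 1 ≤ l) (n : ℕ) :
    truncNorm n ((1 - PowerSeries.X ^ l) * expSeries fun j => θ * (1 - y ^ j)) ≤
      2 * Real.exp (θ * ∑ j ∈ Icc 1 (l - 1), (1 - y ^ j) / j) := by
  have hnonneg : ∀ j : ℕ, 0 ≤ θ * (1 - y ^ j) := fun j =>
    mul_nonneg hθ₀ (sub_nonneg.2 (pow_le_one₀ hy₀.le hy₁))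
  refine (truncNorm_one_sub_X_pow_mul_le_of_antitone
    (antitone_expCoeff_mul_one_sub_pow hθ₀ hθ₁ hy₀) (expCoeff_nonneg hnonneg) l n).trans ?_
  have hsum := sum_expCoeff_le_exp hnonneg (l - 1)
  simp only [Nat.sub_add_cancel hl, mul_div_assoc, ← mul_sum] at hsum
  gcongr
  exact hsum

theorem truncNorm_one_sub_X_pow_mul_expSeries_le {b : ℕ → ℝ} {u : ℕ → 𝕜} (hθ₀ : 0 ≤ θ)
    (hθ₁ : θ ≤ 1) (hy₀ : 0 < y) (hy₁ : y ≤ 1) (hb : ∀ j, 0 ≤ b j)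
    (hu : ∀ j, ‖u j - (θ * (1 - y ^ j) : ℝ)‖ ≤ b j + θ * y ^ j) {l : ℕ} (hl : 1 ≤ l) (n : ℕ) :
    truncNorm n ((1 - PowerSeries.X ^ l) * expSeries u) ≤
      2 * Real.exp (θ * variationExponent n l y) * ∑ i ∈ range (n + 1), expCoeff b i := by
  set h : ℕ → ℝ := fun j => θ * (1 - y ^ j)
  have hsplit : (1 - PowerSeries.X ^ l) * expSeries u =
      PowerSeries.map (algebraMap ℝ 𝕜) ((1 - PowerSeries.X ^ l) * expSeries h) *
        expSeries (fun j => u j - (h j : 𝕜)) := by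
    rw [map_mul, map_expSeries, mul_assoc, ← expSeries_add, map_sub, map_one, map_pow,
      PowerSeries.map_X]
    congr 2
    ext j
    simp
  have hh := truncNorm_one_sub_X_pow_mul_expSeries_mul_one_sub_pow_le hθ₀ hθ₁ hy₀ hy₁ hl n
  have hrest := (truncNorm_expSeries_le hu n).trans
    (sum_expCoeff_add_le_mul_exp hb (fun j => mul_nonneg hθ₀ (pow_nonneg hy₀.le j)) n)
  simp only [mul_div_assoc, ← mul_sum] at hrest
  calc truncNorm n ((1 - PowerSeries.X ^ l) * expSeries u)
      ≤ truncNorm n ((1 - PowerSeries.X ^ l) * expSeries h) *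
          truncNorm n (expSeries fun j => u j - (h j : 𝕜)) := by
        rw [hsplit, ← truncNorm_map (φ := algebraMap ℝ 𝕜) (norm_algebraMap' 𝕜)]
        exact truncNorm_mul_le n _ _
    _ ≤ _ := mul_le_mul hh hrest (truncNorm_nonneg n _) (by positivity)
    _ = _ := by rw [variationExponent, mul_add, Real.exp_add]; ring

theorem natCast_mul_expCoeff_sub {K : Type*} [Field K] [CharZero K] (u : ℕ → K) {l n : ℕ}
    (hln : l ≤ n) :
    n * (expCoeff u n - expCoeff u (n - l)) = -(l * expCoeff u (n - l)) +
      ∑ i ∈ range n, u (n - i) *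
        PowerSeries.coeff i ((1 - PowerSeries.X ^ l) * expSeries u) := by
  rw [← coeff_tailSeries_mul, mul_left_comm, ← X_mul_derivative_expSeries,
    coeff_one_sub_X_pow_mul, if_pos hln, coeff_X_mul_derivative, coeff_X_mul_derivative,
    Nat.cast_sub hln, expCoeff, expCoeff]
  ring

theorem natCast_mul_norm_expCoeff_sub_le {D : ℝ} {u : ℕ → 𝕜} (hu : ∀ j, ‖u j‖ ≤ D) {l n : ℕ}
    (hln : l ≤ n) :
    n * ‖expCoeff u n - expCoeff u (n - l)‖ ≤ l * ‖expCoeff u (n - l)‖ +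
      D * truncNorm n ((1 - PowerSeries.X ^ l) * expSeries u) := by
  have hD : 0 ≤ D := (norm_nonneg _).trans (hu 0)
  rw [← RCLike.norm_natCast (K := 𝕜) n, ← norm_mul, natCast_mul_expCoeff_sub u hln]
  refine (norm_add_le _ _).trans (add_le_add (by simp) ?_)
  calc ‖∑ i ∈ range n, u (n - i) * PowerSeries.coeff i ((1 - PowerSeries.X ^ l) * expSeries u)‖
      ≤ ∑ i ∈ range n, D * ‖PowerSeries.coeff i ((1 - PowerSeries.X ^ l) * expSeries u)‖ :=
        norm_sum_le_of_le _ fun i _ => (norm_mul_le _ _).trans (by gcongr; exact hu _)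
    _ ≤ D * truncNorm n ((1 - PowerSeries.X ^ l) * expSeries u) := by
        rw [← mul_sum, truncNorm]
        gcongr
        exact n.le_succ

end Variation

section SummatoryGrowth

variable {b d : ℕ → ℝ} {θ δ D : ℝ}

theorem sum_expCoeff_succ_le (hb : ∀ j, 0 ≤ b j) (hbD : ∀ j, b j ≤ D) (n : ℕ) :
    ∑ i ∈ range (n + 2), expCoeff b i ≤
      (1 + D / (n + 1)) * ∑ i ∈ range (n + 1), expCoeff b i := by
  have hlast : (n + 1) * expCoeff b (n + 1) ≤ D * ∑ i ∈ range (n + 1), expCoeff b i := by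
    rw [← Nat.cast_succ, natCast_mul_expCoeff, mul_sum]
    exact sum_le_sum fun i _ => mul_le_mul_of_nonneg_right (hbD _) (expCoeff_nonneg hb i)
  rw [sum_range_succ, add_mul, one_mul, div_mul_eq_mul_div, add_le_add_iff_left,
    le_div_iff₀' (by positivity)]
  exact hlast

theorem sum_expCoeff_add_le (hb : ∀ j, 0 ≤ b j) (hbD : ∀ j, b j ≤ D) (m k : ℕ) :
    ∑ i ∈ range (m + k + 1), expCoeff b i ≤
      Real.exp (D * k / (m + 1)) * ∑ i ∈ range (m + 1), expCoeff b i := by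
  have hD : 0 ≤ D := (hb 0).trans (hbD 0)
  induction k with
  | zero => simp
  | succ k ih =>
    calc ∑ i ∈ range (m + k + 2), expCoeff b i
        ≤ (1 + D / ((m + k : ℕ) + 1)) * ∑ i ∈ range (m + k + 1), expCoeff b i :=
          sum_expCoeff_succ_le hb hbD (m + k)
      _ ≤ Real.exp (D / (m + 1)) * ∑ i ∈ range (m + k + 1), expCoeff b i := by
          gcongr
          · exact sum_nonneg fun i _ => expCoeff_nonneg hb i
          · rw [add_comm]
            refine le_trans ?_ (Real.add_one_le_exp _)
            gcongr
            exact le_self_add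
      _ ≤ Real.exp (D / (m + 1)) *
            (Real.exp (D * k / (m + 1)) * ∑ i ∈ range (m + 1), expCoeff b i) := by gcongr
      _ = Real.exp (D * (k + 1 : ℕ) / (m + 1)) * ∑ i ∈ range (m + 1), expCoeff b i := by
          rw [← mul_assoc, ← Real.exp_add]
          congr 2
          push_cast
          ring

theorem sum_expCoeff_le_exp_mul_sum_half (hb : ∀ j, 0 ≤ b j) (hbD : ∀ j, b j ≤ D) (n : ℕ) :
    ∑ i ∈ range (n + 1), expCoeff b i ≤
      Real.exp D * ∑ i ∈ range (n / 2 + 1), expCoeff b i := by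
  have hD : 0 ≤ D := (hb 0).trans (hbD 0)
  have h := sum_expCoeff_add_le hb hbD (n / 2) (n - n / 2)
  rw [Nat.add_sub_cancel' (n.div_le_self 2)] at h
  refine h.trans ?_
  gcongr
  · exact sum_nonneg fun i _ => expCoeff_nonneg hb i
  · rw [mul_div_assoc]
    refine mul_le_of_le_one_right hD ((div_le_one (by positivity)).2 ?_)
    exact_mod_cast (by omega : n - n / 2 ≤ n / 2 + 1)

theorem rpow_le_expCoeff_const (hθ₀ : 0 ≤ θ) (hθ₁ : θ ≤ 1) (k : ℕ) :
    ((k : ℝ) + 1) ^ θ ≤ expCoeff (fun _ => θ + 1) k := by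
  induction k with
  | zero => simp [expCoeff_zero]
  | succ k ih =>
    have hk : (0 : ℝ) < k + 1 := by positivity
    have hrec : expCoeff (fun _ => θ + 1) (k + 1) =
        (1 + θ * (1 / (k + 1))) * expCoeff (fun _ => θ + 1) k := by
      have hsucc := natCast_mul_expCoeff (fun _ => θ + 1) (k + 1)
      rw [sum_range_succ, ← natCast_mul_expCoeff (fun _ => θ + 1) k] at hsucc
      push_cast at hsucc
      field_simp
      linarith
    calc ((k + 1 : ℕ) + 1 : ℝ) ^ θ = (1 + 1 / (k + 1)) ^ θ * ((k : ℝ) + 1) ^ θ := by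
          rw [← Real.mul_rpow (by positivity) hk.le]
          congr 1
          push_cast
          field_simp
      _ ≤ (1 + θ * (1 / (k + 1))) * expCoeff (fun _ => θ + 1) k := by
          gcongr
          exact rpow_one_add_le_one_add_mul_self
            ((neg_one_lt_zero).le.trans (by positivity)) hθ₀ hθ₁
      _ = expCoeff (fun _ => θ + 1) (k + 1) := hrec.symm

theorem rpow_mul_sum_expCoeff_sub_half_le (hθ₀ : 0 ≤ θ) (hθ₁ : θ ≤ 1) (hd : ∀ j, θ ≤ d j)
    (n : ℕ) :
    ((n : ℝ) / 2) ^ θ * ∑ i ∈ range (n / 2 + 1), expCoeff (fun j => d j - θ) i ≤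
      ∑ i ∈ range (n + 1), expCoeff d i := by
  have hnonneg := expCoeff_nonneg (a := fun j => d j - θ) fun j => sub_nonneg.2 (hd j)
  have hconv : ∑ i ∈ range (n + 1), expCoeff d i = ∑ i ∈ range (n + 1),
      expCoeff (fun _ => θ + 1) (n - i) * expCoeff (fun j => d j - θ) i := by
    rw [← expCoeff_add_one, show d + 1 = (fun j => d j - θ) + fun _ => θ + 1 by ext j; simp; ring,
      expCoeff_add]
    simp only [mul_comm]
  rw [hconv, mul_sum]
  calc ∑ i ∈ range (n / 2 + 1), ((n : ℝ) / 2) ^ θ * expCoeff (fun j => d j - θ) i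
      ≤ ∑ i ∈ range (n / 2 + 1),
          expCoeff (fun _ => θ + 1) (n - i) * expCoeff (fun j => d j - θ) i := by
        gcongr with i hi
        · exact hnonneg i
        · refine le_trans ?_ (rpow_le_expCoeff_const hθ₀ hθ₁ (n - i))
          have hhalf : n ≤ (n - i + 1) * 2 := by rw [mem_range] at hi; omega
          gcongr
          rw [div_le_iff₀ two_pos]
          exact_mod_cast hhalf
    _ ≤ _ := sum_le_sum_of_subset_of_nonneg (range_mono (by omega)) fun i _ _ =>
        mul_nonneg (expCoeff_nonneg (fun _ => by positivity) _) (hnonneg i)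

theorem rpow_mul_sum_expCoeff_sub_le (hθ₀ : 0 ≤ θ) (hθ₁ : θ ≤ 1) (hd : ∀ j, θ ≤ d j)
    (hdD : ∀ j, d j ≤ D) (n : ℕ) :
    (n : ℝ) ^ θ * ∑ i ∈ range (n + 1), expCoeff (fun j => d j - θ) i ≤
      2 * Real.exp D * ∑ i ∈ range (n + 1), expCoeff d i := by
  have htwo : (2 : ℝ) ^ θ ≤ 2 :=
    Real.rpow_le_self_of_one_le one_le_two hθ₁
  have hP : 0 ≤ ∑ i ∈ range (n + 1), expCoeff d i :=
    sum_nonneg fun i _ => expCoeff_nonneg (fun j => hθ₀.trans (hd j)) i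
  calc (n : ℝ) ^ θ * ∑ i ∈ range (n + 1), expCoeff (fun j => d j - θ) i
      ≤ (n : ℝ) ^ θ * (Real.exp D * ∑ i ∈ range (n / 2 + 1), expCoeff (fun j => d j - θ) i) := by
        gcongr
        exact sum_expCoeff_le_exp_mul_sum_half (fun j => sub_nonneg.2 (hd j))
          (fun j => (sub_le_self _ hθ₀).trans (hdD j)) n
    _ = 2 ^ θ * Real.exp D *
          (((n : ℝ) / 2) ^ θ * ∑ i ∈ range (n / 2 + 1), expCoeff (fun j => d j - θ) i) := by
        rw [Real.div_rpow n.cast_nonneg zero_le_two]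
        field_simp
    _ ≤ 2 ^ θ * Real.exp D * ∑ i ∈ range (n + 1), expCoeff d i := by
        gcongr
        exact rpow_mul_sum_expCoeff_sub_half_le hθ₀ hθ₁ hd n
    _ ≤ 2 * Real.exp D * ∑ i ∈ range (n + 1), expCoeff d i := by gcongr

theorem sum_expCoeff_le_mul (hδ : 0 < δ) (hd : ∀ j, δ ≤ d j) {n : ℕ} (hn : 1 ≤ n) :
    ∑ i ∈ range (n + 1), expCoeff d i ≤ (1 / δ + 1) * (n * expCoeff d n) := by
  have hnonneg := expCoeff_nonneg fun j => hδ.le.trans (hd j)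
  have hinit : δ * ∑ i ∈ range n, expCoeff d i ≤ n * expCoeff d n := by
    rw [natCast_mul_expCoeff, mul_sum]
    exact sum_le_sum fun i _ => mul_le_mul_of_nonneg_right (hd _) (hnonneg i)
  rw [sum_range_succ, add_mul, one_mul, one_div_mul_eq_div]
  exact add_le_add ((le_div_iff₀' hδ).2 hinit)
    (le_mul_of_one_le_left (hnonneg n) (Nat.one_le_cast.2 hn))

end SummatoryGrowth

section VariationExponent

variable {n l : ℕ} {θ y : ℝ}

theorem sum_one_div_le_one_add_log (n : ℕ) :
    ∑ j ∈ Icc 1 n, (1 : ℝ) / j ≤ 1 + Real.log n := by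
  simpa [harmonic_eq_sum_Icc] using harmonic_le_one_add_log n

theorem sum_pow_div_le_one_add_log (hy₀ : 0 ≤ y) (hy₁ : y ≤ 1) (n : ℕ) :
    ∑ j ∈ Icc 1 n, y ^ j / j ≤ 1 + Real.log n :=
  (sum_le_sum fun j _ => by gcongr; exact pow_le_one₀ hy₀ hy₁).trans
    (sum_one_div_le_one_add_log n)

theorem sum_pow_div_le_neg_log (hy₀ : 0 ≤ y) (hy₁ : y < 1) (n : ℕ) :
    ∑ j ∈ Icc 1 n, y ^ j / j ≤ -Real.log (1 - y) := by
  have hsum := Real.hasSum_pow_div_log_of_abs_lt_one (abs_lt.2 ⟨by linarith, hy₁⟩)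
  rw [sum_Icc_one_eq_sum_range, ← hsum.tsum_eq]
  push_cast
  exact hsum.summable.sum_le_tsum _ fun i _ => by positivity

theorem sum_Ico_pow_div_le_one (hy₀ : 0 ≤ y) (h : 1 ≤ l * (1 - y)) (m : ℕ) :
    ∑ j ∈ Ico l m, y ^ j / j ≤ 1 := by
  have hpos : (0 : ℝ) < l ∧ 0 < 1 - y :=
    (pos_and_pos_or_neg_and_neg_of_mul_pos (one_pos.trans_le h)).resolve_right
      fun hneg => hneg.1.not_ge l.cast_nonneg
  have hy₁ : y < 1 := sub_pos.1 hpos.2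
  calc ∑ j ∈ Ico l m, y ^ j / (j : ℝ)
      ≤ ∑ j ∈ Ico l m, y ^ j / (l : ℝ) := by
        gcongr with j hj
        · exact hpos.1
        · exact (mem_Ico.1 hj).1
    _ = (∑ j ∈ Ico l m, y ^ j) / l := by rw [sum_div]
    _ ≤ (1 - y)⁻¹ / l := by
        rw [← tsum_geometric_of_lt_one hy₀ hy₁]
        gcongr
        exact (summable_geometric_of_lt_one hy₀ hy₁).sum_le_tsum _ fun _ _ => by positivity
    _ ≤ 1 := by
        rw [← one_div, div_div, div_le_one (mul_pos hpos.2 hpos.1), mul_comm]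
        exact h

theorem sum_one_sub_pow_div_le_one (hy₀ : 0 ≤ y) (hy₁ : y ≤ 1) (h : l * (1 - y) ≤ 1) :
    ∑ j ∈ Icc 1 (l - 1), (1 - y ^ j) / j ≤ 1 := by
  calc ∑ j ∈ Icc 1 (l - 1), (1 - y ^ j) / (j : ℝ)
      ≤ ∑ j ∈ Icc 1 (l - 1), (1 - y) := by
        refine sum_le_sum fun j hj => ?_
        have hbernoulli := one_add_mul_le_pow (a := y - 1) (by linarith) j
        rw [add_sub_cancel] at hbernoulli
        rw [div_le_iff₀ (Nat.cast_pos.2 (mem_Icc.1 hj).1)]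
        linarith
    _ = ((l - 1 : ℕ) : ℝ) * (1 - y) := by
        rw [sum_const, Nat.card_Icc, Nat.add_sub_cancel, nsmul_eq_mul]
    _ ≤ l * (1 - y) := by
        have : 0 ≤ 1 - y := sub_nonneg.2 hy₁
        gcongr
        exact l.sub_le 1
    _ ≤ 1 := h

theorem variationExponent_le_of_one_le (hy₀ : 0 ≤ y) (h : 1 ≤ l * (1 - y)) (n : ℕ) :
    variationExponent n l y ≤ 2 + Real.log l := by
  have hsplit : ∑ j ∈ Icc 1 n, y ^ j / (j : ℝ) ≤
      ∑ j ∈ Icc 1 (l - 1), y ^ j / (j : ℝ) + ∑ j ∈ Ico l (n + 1), y ^ j / (j : ℝ) := by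
    have hdisj : Disjoint (Icc 1 (l - 1)) (Ico l (n + 1)) := disjoint_left.2 fun j hj hj' => by
      simp only [mem_Icc, mem_Ico] at hj hj'
      omega
    rw [← sum_union hdisj]
    refine sum_le_sum_of_subset_of_nonneg (fun j hj => ?_) fun j _ _ => by positivity
    simp only [mem_Icc, mem_union, mem_Ico] at hj ⊢
    omega
  have hhead : ∑ j ∈ Icc 1 (l - 1), (1 - y ^ j) / (j : ℝ) +
      ∑ j ∈ Icc 1 (l - 1), y ^ j / (j : ℝ) ≤ 1 + Real.log l := by
    simp only [← sum_add_distrib, ← add_div, sub_add_cancel]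
    exact (sum_le_sum_of_subset_of_nonneg (Icc_subset_Icc_right (l.sub_le 1))
      fun _ _ _ => by positivity).trans (sum_one_div_le_one_add_log l)
  have htail := sum_Ico_pow_div_le_one hy₀ h (n + 1)
  unfold variationExponent
  linarith

theorem variationExponent_le_of_le_one (hy₀ : 0 ≤ y) (hy₁ : y < 1) (h : l * (1 - y) ≤ 1)
    (n : ℕ) : variationExponent n l y ≤ 2 - Real.log (1 - y) := by
  have hsum := add_le_add (sum_one_sub_pow_div_le_one hy₀ hy₁.le h)
    (sum_pow_div_le_neg_log hy₀ hy₁ n)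
  unfold variationExponent
  linarith

theorem exp_mul_variationExponent_le_of_one_le (hθ₀ : 0 ≤ θ) (hθ₁ : θ ≤ 1) (hl : 1 ≤ l)
    (hy₀ : 0 ≤ y) (h : 1 ≤ l * (1 - y)) (n : ℕ) :
    Real.exp (θ * variationExponent n l y) ≤ Real.exp 2 * (l : ℝ) ^ θ := by
  rw [Real.rpow_def_of_pos (Nat.cast_pos.2 hl), ← Real.exp_add, Real.exp_le_exp]
  linarith [mul_le_mul_of_nonneg_left (variationExponent_le_of_one_le hy₀ h n) hθ₀]

theorem exp_mul_variationExponent_le_of_le_one (hθ₀ : 0 ≤ θ) (hθ₁ : θ ≤ 1) (hy₀ : 0 ≤ y)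
    (hy₁ : y < 1) (h : l * (1 - y) ≤ 1) (n : ℕ) :
    Real.exp (θ * variationExponent n l y) ≤ Real.exp 2 * (1 - y) ^ (-θ) := by
  rw [Real.rpow_def_of_pos (sub_pos.2 hy₁), ← Real.exp_add, Real.exp_le_exp]
  linarith [mul_le_mul_of_nonneg_left (variationExponent_le_of_le_one hy₀ hy₁ h n) hθ₀]

theorem exp_variationExponent_le (hn : 1 ≤ n) (hy₀ : 0 ≤ y) (hy₁ : y ≤ 1)
    (h : l * (1 - y) ≤ 1) : Real.exp (variationExponent n l y) ≤ Real.exp 2 * n := by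
  rw [← Real.exp_log (Nat.cast_pos.2 hn : (0 : ℝ) < n), ← Real.exp_add, Real.exp_le_exp,
    variationExponent]
  linarith [sum_one_sub_pow_div_le_one hy₀ hy₁ h, sum_pow_div_le_one_add_log hy₀ hy₁ n]

@[fun_prop]
theorem continuous_variationExponent (n l : ℕ) : Continuous (variationExponent n l) := by
  unfold variationExponent
  fun_prop

end VariationExponent

section VariationIntegral

open intervalIntegral

variable {n l : ℕ} {θ : ℝ}

/-- Up to a constant, the bound for the contribution of the cycle length `l` to the derivative at
`y` of the interpolation between the constant function `1` and `f`. -/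
noncomputable def variationIntegrand (θ : ℝ) (n l : ℕ) (y : ℝ) : ℝ :=
  y ^ (l - 1) * Real.exp (θ * variationExponent n l y)

/-- The integral of `variationIntegrand` over the whole interpolation: up to a constant, the
contribution of the cycle length `l` to the error. -/
noncomputable def variationIntegral (θ : ℝ) (n l : ℕ) : ℝ :=
  ∫ y in (0 : ℝ)..1, variationIntegrand θ n l y

@[fun_prop]
theorem continuous_variationIntegrand (θ : ℝ) (n l : ℕ) :
    Continuous (variationIntegrand θ n l) := by
  unfold variationIntegrand
  fun_prop

theorem variationIntegral_nonneg (θ : ℝ) (n l : ℕ) : 0 ≤ variationIntegral θ n l :=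
  integral_nonneg zero_le_one fun _ hy => mul_nonneg (pow_nonneg hy.1 _) (Real.exp_pos _).le

theorem intervalIntegrable_variationIntegrand (θ : ℝ) (n l : ℕ) (a b : ℝ) :
    IntervalIntegrable (variationIntegrand θ n l) MeasureTheory.volume a b :=
  (continuous_variationIntegrand θ n l).intervalIntegrable a b

theorem integral_variationIntegrand_le {a b : ℝ} {g : ℝ → ℝ} (ha : 0 ≤ a)
    (hab : a ≤ b) (hb : b ≤ 1) (hg : IntervalIntegrable g MeasureTheory.volume a b)
    (h : ∀ y ∈ Set.Ioo a b, Real.exp (θ * variationExponent n l y) ≤ g y) :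
    ∫ y in a..b, variationIntegrand θ n l y ≤ ∫ y in a..b, g y :=
  integral_mono_on_of_le_Ioo hab
    (intervalIntegrable_variationIntegrand θ n l a b) hg fun y hy =>
      (mul_le_of_le_one_left (Real.exp_pos _).le
        (pow_le_one₀ (ha.trans hy.1.le) (hy.2.le.trans hb))).trans (h y hy)

theorem natCast_mul_one_sub_le_one (hl : 1 ≤ l) {y : ℝ} (hy : 1 - 1 / (l : ℝ) ≤ y) :
    l * (1 - y) ≤ 1 :=
  (le_div_iff₀' (Nat.cast_pos.2 hl)).1 (sub_le_comm.1 hy)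

theorem one_le_natCast_mul_one_sub (hl : 1 ≤ l) {y : ℝ} (hy : y ≤ 1 - 1 / (l : ℝ)) :
    1 ≤ l * (1 - y) :=
  (div_le_iff₀' (Nat.cast_pos.2 hl)).1 (le_sub_comm.1 hy)

theorem integral_variationIntegrand_left_le (hθ₀ : 0 ≤ θ) (hθ₁ : θ ≤ 1) (hl : 1 ≤ l) :
    ∫ y in (0 : ℝ)..(1 - 1 / l), variationIntegrand θ n l y ≤
      Real.exp 2 * (l : ℝ) ^ (θ - 1) := by
  have hl₀ : (0 : ℝ) < l := Nat.cast_pos.2 hl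
  have ha : 0 ≤ 1 - 1 / (l : ℝ) := Nat.one_sub_one_div_cast_nonneg l
  have ha₁ : 1 - 1 / (l : ℝ) ≤ 1 := sub_le_self _ (by positivity)
  calc ∫ y in (0 : ℝ)..(1 - 1 / l), variationIntegrand θ n l y
      ≤ ∫ y in (0 : ℝ)..(1 - 1 / l), y ^ (l - 1) * (Real.exp 2 * (l : ℝ) ^ θ) := by
        refine integral_mono_on ha (intervalIntegrable_variationIntegrand θ n l _ _)
          (Continuous.intervalIntegrable (by fun_prop) _ _) fun y hy => ?_
        exact mul_le_mul_of_nonneg_left (exp_mul_variationExponent_le_of_one_le hθ₀ hθ₁ hl hy.1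
          (one_le_natCast_mul_one_sub hl hy.2) n) (pow_nonneg hy.1 _)
    _ = (1 - 1 / (l : ℝ)) ^ l / l * (Real.exp 2 * (l : ℝ) ^ θ) := by
        rw [integral_mul_const, integral_pow, Nat.sub_add_cancel hl, zero_pow (by omega),
          sub_zero, Nat.cast_pred hl, sub_add_cancel]
    _ ≤ 1 / l * (Real.exp 2 * (l : ℝ) ^ θ) := by
        gcongr
        exact pow_le_one₀ ha ha₁
    _ = Real.exp 2 * (l : ℝ) ^ (θ - 1) := by
        rw [Real.rpow_sub_one hl₀.ne']
        ring

theorem integral_variationIntegrand_right_le (hθ₀ : 0 ≤ θ) (hθ₁ : θ < 1) (hl : 1 ≤ l) :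
    ∫ y in (1 - 1 / (l : ℝ))..1, variationIntegrand θ n l y ≤
      Real.exp 2 * ((l : ℝ) ^ (θ - 1) / (1 - θ)) := by
  have ha : 0 ≤ 1 - 1 / (l : ℝ) := Nat.one_sub_one_div_cast_nonneg l
  have h_int : IntervalIntegrable (fun y : ℝ => (1 - y) ^ (-θ)) MeasureTheory.volume
      (1 - 1 / (l : ℝ)) 1 := by
    simpa using (intervalIntegrable_rpow' (r := -θ) (by linarith)
      (a := 1 / (l : ℝ)) (b := 0)).comp_sub_left 1
  calc ∫ y in (1 - 1 / (l : ℝ))..1, variationIntegrand θ n l y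
      ≤ ∫ y in (1 - 1 / (l : ℝ))..1, Real.exp 2 * (1 - y) ^ (-θ) :=
        integral_variationIntegrand_le ha (sub_le_self _ (by positivity)) le_rfl
          (h_int.const_mul _) fun y hy => exp_mul_variationExponent_le_of_le_one hθ₀ hθ₁.le
            (ha.trans hy.1.le) hy.2 (natCast_mul_one_sub_le_one hl hy.1.le) n
    _ = Real.exp 2 * ((1 / (l : ℝ)) ^ (1 - θ) / (1 - θ)) := by
        rw [integral_const_mul, integral_comp_sub_left (fun x => x ^ (-θ)) 1, sub_self,
          sub_sub_cancel, integral_rpow (Or.inl (by linarith)), neg_add_eq_sub,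
          Real.zero_rpow (by linarith), sub_zero]
    _ = Real.exp 2 * ((l : ℝ) ^ (θ - 1) / (1 - θ)) := by
        rw [one_div, Real.inv_rpow l.cast_nonneg, ← Real.rpow_neg l.cast_nonneg, neg_sub]

theorem variationIntegral_le (hθ₀ : 0 ≤ θ) (hθ₁ : θ < 1) (hl : 1 ≤ l) :
    variationIntegral θ n l ≤ Real.exp 2 * (1 + 1 / (1 - θ)) * (l : ℝ) ^ (θ - 1) := by
  have h_int := intervalIntegrable_variationIntegrand θ n l
  rw [variationIntegral, ← integral_add_adjacent_intervals (h_int 0 (1 - 1 / l)) (h_int _ 1)]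
  calc _ ≤ Real.exp 2 * (l : ℝ) ^ (θ - 1) + Real.exp 2 * ((l : ℝ) ^ (θ - 1) / (1 - θ)) :=
        add_le_add (integral_variationIntegrand_left_le hθ₀ hθ₁.le hl)
          (integral_variationIntegrand_right_le hθ₀ hθ₁ hl)
    _ = _ := by ring

theorem integral_variationIntegrand_middle_le (hl : 1 ≤ l) (hln : l ≤ n) :
    ∫ y in (1 - 1 / (l : ℝ))..(1 - 1 / n), variationIntegrand 1 n l y ≤
      Real.exp 2 * Real.log (n / l) := by
  have : (0 : ℝ) < l := Nat.cast_pos.2 hl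
  have hn₀ : (0 : ℝ) < 1 / n := one_div_pos.2 (Nat.cast_pos.2 (hl.trans hln))
  have ha : 0 ≤ 1 - 1 / (l : ℝ) := Nat.one_sub_one_div_cast_nonneg l
  have hab : 1 - 1 / (l : ℝ) ≤ 1 - 1 / n := by gcongr
  have h_int : IntervalIntegrable (fun y : ℝ => (1 - y)⁻¹) MeasureTheory.volume
      (1 - 1 / (l : ℝ)) (1 - 1 / n) := by
    refine ContinuousOn.intervalIntegrable (ContinuousOn.inv₀ (by fun_prop) fun y hy => ?_)
    rw [Set.uIcc_of_le hab] at hy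
    linarith [hy.2]
  calc ∫ y in (1 - 1 / (l : ℝ))..(1 - 1 / n), variationIntegrand 1 n l y
      ≤ ∫ y in (1 - 1 / (l : ℝ))..(1 - 1 / n), Real.exp 2 * (1 - y)⁻¹ :=
        integral_variationIntegrand_le ha hab (sub_le_self _ hn₀.le)
          (h_int.const_mul _) fun y hy => by
            rw [← Real.rpow_neg_one]
            exact exp_mul_variationExponent_le_of_le_one zero_le_one le_rfl (ha.trans hy.1.le)
              (by linarith [hy.2]) (natCast_mul_one_sub_le_one hl hy.1.le) n
    _ = Real.exp 2 * Real.log (n / l) := by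
        rw [integral_const_mul, integral_comp_sub_left (fun x => x⁻¹) 1, sub_sub_cancel,
          sub_sub_cancel, integral_inv_of_pos hn₀ (by positivity), one_div, one_div, inv_div_inv]

theorem integral_variationIntegrand_last_le (hn : 1 ≤ n) (hln : l ≤ n) :
    ∫ y in (1 - 1 / (n : ℝ))..1, variationIntegrand 1 n l y ≤ Real.exp 2 := by
  have ha : 0 ≤ 1 - 1 / (n : ℝ) := Nat.one_sub_one_div_cast_nonneg n
  calc ∫ y in (1 - 1 / (n : ℝ))..1, variationIntegrand 1 n l y
      ≤ ∫ _ in (1 - 1 / (n : ℝ))..1, Real.exp 2 * n := by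
        refine integral_variationIntegrand_le ha (sub_le_self _ (by positivity))
          le_rfl (Continuous.intervalIntegrable (by fun_prop) _ _) fun y hy => ?_
        rw [one_mul]
        refine exp_variationExponent_le hn (ha.trans hy.1.le) hy.2.le ?_
        refine le_trans ?_ (natCast_mul_one_sub_le_one hn hy.1.le)
        gcongr
        exact sub_nonneg.2 hy.2.le
    _ = Real.exp 2 := by
        rw [integral_const, sub_sub_cancel, smul_eq_mul]
        field_simp

theorem variationIntegral_one_le (hl : 1 ≤ l) (hln : l ≤ n) :
    variationIntegral 1 n l ≤ 2 * Real.exp 2 * (1 + Real.log (n / l)) := by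
  have h_int := intervalIntegrable_variationIntegrand 1 n l
  have hleft := integral_variationIntegrand_left_le (n := n) zero_le_one le_rfl hl
  rw [sub_self, Real.rpow_zero, mul_one] at hleft
  have hlog : 0 ≤ Real.log (n / l) :=
    Real.log_nonneg ((one_le_div (Nat.cast_pos.2 hl)).2 (Nat.cast_le.2 hln))
  rw [variationIntegral, ← integral_add_adjacent_intervals (h_int 0 (1 - 1 / l)) (h_int _ 1),
    ← integral_add_adjacent_intervals (h_int (1 - 1 / l) (1 - 1 / n)) (h_int _ 1)]
  calc _ ≤ Real.exp 2 + (Real.exp 2 * Real.log (n / l) + Real.exp 2) :=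
        add_le_add hleft (add_le_add (integral_variationIntegrand_middle_le hl hln)
          (integral_variationIntegrand_last_le (hl.trans hln) hln))
    _ = Real.exp 2 * (2 + 1 * Real.log (n / l)) := by ring
    _ ≤ Real.exp 2 * (2 + 2 * Real.log (n / l)) := by
        gcongr
        exact one_le_two
    _ = _ := by ring

end VariationIntegral

section Interpolation

theorem expCoeff_mul_pow_add {K : Type*} [Field K] [CharZero K] (a b : ℕ → K) (y : K) (n : ℕ) :
    expCoeff (fun j => a j * y ^ j + b j) n =
      ∑ k ∈ range (n + 1), expCoeff a k * y ^ k * expCoeff b (n - k) := by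
  simp only [← expCoeff_mul_pow]
  exact expCoeff_add (fun j => a j * y ^ j) b n

theorem coeff_tailSeries_mul_expSeries_mul_pow {K : Type*} [Field K] [CharZero K] (a : ℕ → K)
    (y : K) (n : ℕ) :
    PowerSeries.coeff n (tailSeries (fun j => a j * y ^ (j - 1)) *
      expSeries fun j => a j * y ^ j) = n * expCoeff a n * y ^ (n - 1) := by
  rw [coeff_tailSeries_mul, natCast_mul_expCoeff, sum_mul]
  refine sum_congr rfl fun i hi => ?_
  have hpow : y ^ (n - 1) = y ^ (n - i - 1) * y ^ i := by
    rw [← pow_add]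
    congr 1
    have := mem_range.1 hi
    omega
  rw [hpow, ← expCoeff, expCoeff_mul_pow]
  ring

theorem sum_mul_pow_mul_expCoeff_mul_pow_add {K : Type*} [Field K] [CharZero K] (a b : ℕ → K)
    (y : K) (n : ℕ) :
    ∑ l ∈ Icc 1 n, a l * y ^ (l - 1) * expCoeff (fun j => a j * y ^ j + b j) (n - l) =
      ∑ k ∈ range (n + 1), k * expCoeff a k * y ^ (k - 1) * expCoeff b (n - k) := by
  calc ∑ l ∈ Icc 1 n, a l * y ^ (l - 1) * expCoeff (fun j => a j * y ^ j + b j) (n - l)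
      = PowerSeries.coeff n (tailSeries (fun j => a j * y ^ (j - 1)) *
          expSeries ((fun j => a j * y ^ j) + b)) := by
        rw [coeff_tailSeries_mul]
        exact (sum_range_sub_eq_sum_Icc (fun l i => a l * y ^ (l - 1) *
          expCoeff (fun j => a j * y ^ j + b j) i) n).symm
    _ = ∑ k ∈ range (n + 1), k * expCoeff a k * y ^ (k - 1) * expCoeff b (n - k) := by
        rw [expSeries_add, ← mul_assoc, PowerSeries.coeff_mul,
          Nat.sum_antidiagonal_eq_sum_range_succ_mk]
        simp only [coeff_tailSeries_mul_expSeries_mul_pow, expCoeff]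

theorem hasDerivAt_expCoeff_mul_pow_add {𝕜 : Type*} [NontriviallyNormedField 𝕜] [CharZero 𝕜]
    (a b : ℕ → 𝕜) (n : ℕ) (y : 𝕜) :
    HasDerivAt (fun y => expCoeff (fun j => a j * y ^ j + b j) n)
      (∑ l ∈ Icc 1 n, a l * y ^ (l - 1) *
        expCoeff (fun j => a j * y ^ j + b j) (n - l)) y := by
  rw [sum_mul_pow_mul_expCoeff_mul_pow_add]
  simp only [expCoeff_mul_pow_add]
  refine HasDerivAt.fun_sum fun k _ =>
    (((hasDerivAt_pow k y).const_mul _).mul_const _).congr_deriv ?_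
  ring

/-- The path along which `expCoeff (a + b) n`, its value at `y = 1`, is compared with
`expCoeff b n * exp {∑_{l ≤ n} a(l) / l}`, its value at `y = 0`. -/
noncomputable def interpolation (a b : ℕ → ℂ) (n : ℕ) (y : ℂ) : ℂ :=
  expCoeff (fun j => a j * y ^ j + b j) n * Complex.exp (∑ l ∈ Icc 1 n, a l / l * (1 - y ^ l))

theorem interpolation_zero (a b : ℕ → ℂ) (n : ℕ) :
    interpolation a b n 0 = expCoeff b n * Complex.exp (∑ l ∈ Icc 1 n, a l / l) := by
  have hpow : ∀ j ∈ Icc 1 n, (0 : ℂ) ^ j = 0 := fun j hj =>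
    zero_pow (Nat.one_le_iff_ne_zero.1 (mem_Icc.1 hj).1)
  rw [interpolation, expCoeff_congr (b := b) fun j hj => by rw [hpow j hj, mul_zero, zero_add],
    sum_congr rfl fun l hl => by rw [hpow l hl, sub_zero, mul_one]]

theorem interpolation_one (a b : ℕ → ℂ) (n : ℕ) :
    interpolation a b n 1 = expCoeff (a + b) n := by
  simp only [interpolation, one_pow, mul_one, sub_self, mul_zero, sum_const_zero, Complex.exp_zero]
  rfl

theorem hasDerivAt_interpolation (a b : ℕ → ℂ) (n : ℕ) (y : ℂ) :
    HasDerivAt (interpolation a b n)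
      (Complex.exp (∑ l ∈ Icc 1 n, a l / l * (1 - y ^ l)) * ∑ l ∈ Icc 1 n, a l * y ^ (l - 1) *
        (expCoeff (fun j => a j * y ^ j + b j) (n - l) -
          expCoeff (fun j => a j * y ^ j + b j) n)) y := by
  have hlog : HasDerivAt (fun y : ℂ => ∑ l ∈ Icc 1 n, a l / l * (1 - y ^ l))
      (∑ l ∈ Icc 1 n, -(a l * y ^ (l - 1))) y := by
    refine HasDerivAt.fun_sum fun l hl =>
      (((hasDerivAt_pow l y).const_sub 1).const_mul (a l / l)).congr_deriv ?_
    have hl₀ : (l : ℂ) ≠ 0 := Nat.cast_ne_zero.2 (Nat.one_le_iff_ne_zero.1 (mem_Icc.1 hl).1)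
    field_simp
  refine ((hasDerivAt_expCoeff_mul_pow_add a b n y).mul hlog.cexp).congr_deriv ?_
  simp only [mul_sub, sum_sub_distrib, sum_neg_distrib, ← sum_mul]
  ring

theorem norm_exp_sum_div_mul_one_sub_pow_le_one {a : ℕ → ℂ} (ha : ∀ j, (a j).re ≤ 0) {y : ℝ}
    (hy₀ : 0 ≤ y) (hy₁ : y ≤ 1) (n : ℕ) :
    ‖Complex.exp (∑ l ∈ Icc 1 n, a l / l * (1 - (y : ℂ) ^ l))‖ ≤ 1 := by
  rw [Complex.norm_exp, Real.exp_le_one_iff, Complex.re_sum]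
  refine sum_nonpos fun l _ => ?_
  have hreal : a l / l * (1 - (y : ℂ) ^ l) = ((1 - y ^ l) / l : ℝ) * a l := by
    push_cast
    ring
  rw [hreal, Complex.re_ofReal_mul]
  exact mul_nonpos_of_nonneg_of_nonpos
    (div_nonneg (sub_nonneg.2 (pow_le_one₀ hy₀ hy₁)) l.cast_nonneg) (ha l)

end Interpolation

section MeanError

theorem norm_mul_sub_one_mul_add_sub_le {d θ s : ℝ} {w : ℂ} (hd₀ : 0 ≤ d) (hθd : θ ≤ d)
    (hs₀ : 0 ≤ s) (hs₁ : s ≤ 1) (hw : ‖w‖ ≤ 1) :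
    ‖(d : ℂ) * (w - 1) * s + d - (θ * (1 - s) : ℝ)‖ ≤ d - θ + θ * s := by
  have hsplit : (d : ℂ) * (w - 1) * s + d - (θ * (1 - s) : ℝ) =
      ((d - θ) * (1 - s) : ℝ) + (d * s : ℝ) * w := by
    push_cast
    ring
  have hnonneg : 0 ≤ d * s ∧ 0 ≤ (d - θ) * (1 - s) :=
    ⟨mul_nonneg hd₀ hs₀, mul_nonneg (sub_nonneg.2 hθd) (sub_nonneg.2 hs₁)⟩
  calc ‖(d : ℂ) * (w - 1) * s + d - (θ * (1 - s) : ℝ)‖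
      ≤ (d - θ) * (1 - s) + d * s * ‖w‖ := by
        rw [hsplit]
        refine (norm_add_le _ _).trans_eq ?_
        rw [norm_mul, Complex.norm_of_nonneg hnonneg.1, Complex.norm_of_nonneg hnonneg.2]
    _ ≤ (d - θ) * (1 - s) + d * s * 1 := by gcongr
    _ = d - θ + θ * s := by ring

variable {d : ℕ → ℝ} {f : ℕ → ℂ} {θ δ D y : ℝ} {n l : ℕ}

theorem norm_expCoeff_sub_expCoeff_le (hθ₀ : 0 ≤ θ) (hθ₁ : θ ≤ 1) (hd : ∀ j, θ ≤ d j)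
    (hdD : ∀ j, d j ≤ D) (hf : ∀ j, ‖f j‖ ≤ 1) (hl : 1 ≤ l) (hln : l ≤ n) (hy₀ : 0 < y)
    (hy₁ : y ≤ 1) {u : ℕ → ℂ} (hu : ∀ j, u j = d j * (f j - 1) * (y : ℂ) ^ j + d j) :
    ‖expCoeff u (n - l) - expCoeff u n‖ ≤
      (l * expCoeff d (n - l) + 2 * D * (∑ i ∈ range (n + 1), expCoeff (fun j => d j - θ) i) *
        Real.exp (θ * variationExponent n l y)) / n := by
  have hd₀ : ∀ j, 0 ≤ d j := fun j => hθ₀.trans (hd j)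
  have hu_sub : ∀ t : ℝ, (∀ j, t ≤ d j) → ∀ j,
      ‖u j - (t * (1 - y ^ j) : ℝ)‖ ≤ d j - t + t * y ^ j := fun t ht j => by
    rw [hu, ← Complex.ofReal_pow]
    exact norm_mul_sub_one_mul_add_sub_le (hd₀ j) (ht j) (pow_nonneg hy₀.le j)
      (pow_le_one₀ hy₀.le hy₁) (hf j)
  have hu_norm : ∀ j, ‖u j‖ ≤ d j := fun j => by simpa using hu_sub 0 hd₀ j
  have hvar := truncNorm_one_sub_X_pow_mul_expSeries_le hθ₀ hθ₁ hy₀ hy₁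
    (fun j => sub_nonneg.2 (hd j)) (hu_sub θ hd) hl n
  have hD : 0 ≤ D := (hd₀ 0).trans (hdD 0)
  rw [norm_sub_rev, le_div_iff₀' (Nat.cast_pos.2 (hl.trans hln))]
  calc n * ‖expCoeff u n - expCoeff u (n - l)‖
      ≤ l * ‖expCoeff u (n - l)‖ + D * truncNorm n ((1 - PowerSeries.X ^ l) * expSeries u) :=
        natCast_mul_norm_expCoeff_sub_le (fun j => (hu_norm j).trans (hdD j)) hln
    _ ≤ l * expCoeff d (n - l) + D * (2 * Real.exp (θ * variationExponent n l y) *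
          ∑ i ∈ range (n + 1), expCoeff (fun j => d j - θ) i) := by
        gcongr
        exact norm_expCoeff_le hu_norm (n - l)
    _ = _ := by ring

theorem norm_deriv_interpolation_le (hθ₀ : 0 ≤ θ) (hθ₁ : θ ≤ 1) (hd : ∀ j, θ ≤ d j)
    (hdD : ∀ j, d j ≤ D) (hf : ∀ j, ‖f j‖ ≤ 1) (n : ℕ) (hy₀ : 0 < y) (hy₁ : y ≤ 1) :
    ‖deriv (interpolation (fun j => d j * (f j - 1)) (fun j => d j) n) y‖ ≤
      ∑ l ∈ Icc 1 n, D * ‖f l - 1‖ * ((expCoeff d (n - l) * (l * y ^ (l - 1)) +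
        2 * D * (∑ i ∈ range (n + 1), expCoeff (fun j => d j - θ) i) *
          variationIntegrand θ n l y) / n) := by
  have hd₀ : ∀ j, 0 ≤ d j := fun j => hθ₀.trans (hd j)
  have hre : ∀ j, ((d j : ℂ) * (f j - 1)).re ≤ 0 := fun j => by
    rw [Complex.re_ofReal_mul, Complex.sub_re, Complex.one_re]
    exact mul_nonpos_of_nonneg_of_nonpos (hd₀ j)
      (sub_nonpos.2 ((Complex.re_le_norm _).trans (hf j)))
  rw [(hasDerivAt_interpolation _ _ n y).deriv, norm_mul]
  refine (mul_le_of_le_one_left (norm_nonneg _)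
    (norm_exp_sum_div_mul_one_sub_pow_le_one hre hy₀.le hy₁ n)).trans ?_
  refine norm_sum_le_of_le _ fun l hl => ?_
  have hdiff := norm_expCoeff_sub_expCoeff_le hθ₀ hθ₁ hd hdD hf (mem_Icc.1 hl).1 (mem_Icc.1 hl).2
    hy₀ hy₁ fun _ => rfl
  rw [norm_mul, norm_mul, norm_mul, norm_pow, Complex.norm_of_nonneg (hd₀ l),
    Complex.norm_of_nonneg hy₀.le]
  have hD : 0 ≤ D := (hd₀ l).trans (hdD l)
  calc _ ≤ D * ‖f l - 1‖ * y ^ (l - 1) * _ :=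
        mul_le_mul (by gcongr; exact hdD l) hdiff (norm_nonneg _) (by positivity)
    _ = _ := by rw [variationIntegrand]; ring

theorem integral_mul_pow_add_mul_variationIntegrand (hl : 1 ≤ l) (p c : ℝ) :
    ∫ y in (0 : ℝ)..1, (p * (l * y ^ (l - 1)) + c * variationIntegrand θ n l y) =
      p + c * variationIntegral θ n l := by
  have hl₀ : (l : ℝ) ≠ 0 := Nat.cast_ne_zero.2 (Nat.one_le_iff_ne_zero.1 hl)
  rw [intervalIntegral.integral_add (Continuous.intervalIntegrable (by fun_prop) _ _)
      (Continuous.intervalIntegrable (by fun_prop) _ _),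
    intervalIntegral.integral_const_mul, intervalIntegral.integral_const_mul,
    intervalIntegral.integral_const_mul, integral_pow, Nat.sub_add_cancel hl, Nat.cast_pred hl,
    variationIntegral, one_pow, zero_pow (by omega), sub_add_cancel, sub_zero,
    mul_one_div_cancel hl₀, mul_one]

theorem norm_expCoeff_sub_exp_le (hθ₀ : 0 ≤ θ) (hθ₁ : θ ≤ 1) (hd : ∀ j, θ ≤ d j)
    (hdD : ∀ j, d j ≤ D) (hf : ∀ j, ‖f j‖ ≤ 1) (n : ℕ) :
    ‖expCoeff (fun j => (d j : ℂ) * f j) n -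
        (expCoeff d n : ℝ) * Complex.exp (∑ j ∈ Icc 1 n, (d j : ℂ) * ((f j - 1) / j))‖ ≤
      ∑ l ∈ Icc 1 n, D * ‖f l - 1‖ * ((expCoeff d (n - l) +
        2 * D * (∑ i ∈ range (n + 1), expCoeff (fun j => d j - θ) i) *
          variationIntegral θ n l) / n) := by
  set S := ∑ i ∈ range (n + 1), expCoeff (fun j => d j - θ) i
  set Φ := interpolation (fun j => d j * (f j - 1)) (fun j => d j) n
  have hΦ : ∀ y : ℝ, HasDerivAt (fun y : ℝ => Φ y) (deriv Φ y) y := fun y =>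
    (hasDerivAt_interpolation _ _ n y).differentiableAt.hasDerivAt.comp_ofReal
  have hΦ₀ : Φ (0 : ℝ) = (expCoeff d n : ℝ) *
      Complex.exp (∑ j ∈ Icc 1 n, (d j : ℂ) * ((f j - 1) / j)) := by
    simp only [Φ, Complex.ofReal_zero, interpolation_zero, mul_div_assoc]
    congr 1
    exact (map_expCoeff Complex.ofRealHom d n).symm
  have hΦ₁ : Φ (1 : ℝ) = expCoeff (fun j => (d j : ℂ) * f j) n := by
    simp only [Φ, Complex.ofReal_one, interpolation_one]
    congr 1
    ext j
    simp only [Pi.add_apply]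
    ring
  rw [← hΦ₀, ← hΦ₁]
  calc ‖Φ (1 : ℝ) - Φ (0 : ℝ)‖
      ≤ ∫ y in (0 : ℝ)..1, ∑ l ∈ Icc 1 n, D * ‖f l - 1‖ *
          ((expCoeff d (n - l) * (l * y ^ (l - 1)) + 2 * D * S * variationIntegrand θ n l y) /
            n) := by
        refine norm_sub_le_integral_of_norm_deriv_le_of_le (f := fun y : ℝ => Φ y) zero_le_one
          (fun y _ => (hΦ y).continuousAt.continuousWithinAt)
          (fun y _ => (hΦ y).differentiableAt.differentiableWithinAt)
          (.of_forall fun y hy => ?_) (Continuous.intervalIntegrable (by fun_prop) _ _)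
        rw [(hΦ y).deriv]
        exact norm_deriv_interpolation_le hθ₀ hθ₁ hd hdD hf n hy.1 hy.2.le
    _ = ∑ l ∈ Icc 1 n, D * ‖f l - 1‖ *
          ((expCoeff d (n - l) + 2 * D * S * variationIntegral θ n l) / n) := by
        rw [intervalIntegral.integral_finsetSum fun l _ =>
          Continuous.intervalIntegrable (by fun_prop) _ _]
        refine sum_congr rfl fun l hl => ?_
        rw [intervalIntegral.integral_const_mul, intervalIntegral.integral_div,
          integral_mul_pow_add_mul_variationIntegrand (mem_Icc.1 hl).1]

theorem meanError_eq_norm_sub_div (hd : ∀ j, 0 < d j) (f : ℕ → ℂ) (n : ℕ) :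
    meanError d n f = ‖expCoeff (fun j => (d j : ℂ) * f j) n - (expCoeff d n : ℝ) *
      Complex.exp (∑ j ∈ Icc 1 n, (d j : ℂ) * ((f j - 1) / j))‖ / expCoeff d n := by
  have hpos : 0 < expCoeff d n := expCoeff_pos hd n
  rw [meanError, weightedMean_eq_div, div_sub' (Complex.ofReal_ne_zero.2 hpos.ne'), norm_div,
    Complex.norm_of_nonneg hpos.le]

theorem meanError_le (hδ : 0 < δ) (hθ₀ : 0 ≤ θ) (hθ₁ : θ ≤ 1) (hθδ : θ ≤ δ) (hd : ∀ j, δ ≤ d j)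
    (hdD : ∀ j, d j ≤ D) (hf : ∀ j, ‖f j‖ ≤ 1) (hn : 1 ≤ n) :
    meanError d n f ≤ D * (1 / δ + 1) * ((∑ j ∈ range (n + 1), pCoeff d j)⁻¹ *
      ∑ k ∈ Icc 1 n, ‖f k - 1‖ * pCoeff d (n - k) + 4 * D * Real.exp D *
        (1 / (n : ℝ) ^ θ * ∑ k ∈ Icc 1 n, ‖f k - 1‖ * variationIntegral θ n k)) := by
  have hd₀ : ∀ j, 0 < d j := fun j => hδ.trans_le (hd j)
  have hD : 0 ≤ D := (hd₀ 0).le.trans (hdD 0)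
  have : (0 : ℝ) < n := Nat.cast_pos.2 hn
  have hpn : 0 < expCoeff d n := expCoeff_pos hd₀ n
  simp only [pCoeff_eq_expCoeff]
  set P := ∑ i ∈ range (n + 1), expCoeff d i
  set S := ∑ i ∈ range (n + 1), expCoeff (fun j => d j - θ) i
  set X := ∑ k ∈ Icc 1 n, ‖f k - 1‖ * expCoeff d (n - k)
  set Y := ∑ k ∈ Icc 1 n, ‖f k - 1‖ * variationIntegral θ n k
  have hX : 0 ≤ X := sum_nonneg fun k _ => mul_nonneg (norm_nonneg _) (expCoeff_pos hd₀ _).le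
  have hY : 0 ≤ Y := sum_nonneg fun k _ =>
    mul_nonneg (norm_nonneg _) (variationIntegral_nonneg θ n k)
  have hS₀ : 0 ≤ S := sum_nonneg fun i _ =>
    expCoeff_nonneg (fun j => sub_nonneg.2 (hθδ.trans (hd j))) i
  have : 0 ≤ X + 2 * D * S * Y := by positivity
  have hP₀ : 0 < P := sum_pos (fun i _ => expCoeff_pos hd₀ i) nonempty_range_add_one
  have hS : S ≤ 2 * Real.exp D * P / (n : ℝ) ^ θ :=
    (le_div_iff₀' (by positivity)).2
      (rpow_mul_sum_expCoeff_sub_le hθ₀ hθ₁ (fun j => hθδ.trans (hd j)) hdD n)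
  have hPn : 1 / (n * expCoeff d n) ≤ (1 / δ + 1) / P := by
    rw [div_le_div_iff₀ (by positivity) hP₀, one_mul]
    exact sum_expCoeff_le_mul hδ hd hn
  calc meanError d n f
      ≤ (∑ l ∈ Icc 1 n, D * ‖f l - 1‖ * ((expCoeff d (n - l) +
          2 * D * S * variationIntegral θ n l) / n)) / expCoeff d n := by
        rw [meanError_eq_norm_sub_div hd₀]
        gcongr
        exact norm_expCoeff_sub_exp_le hθ₀ hθ₁ (fun j => hθδ.trans (hd j)) hdD hf n
    _ = D * (1 / (n * expCoeff d n)) * (X + 2 * D * S * Y) := by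
        simp only [X, Y, mul_sum, sum_div, ← sum_add_distrib]
        refine sum_congr rfl fun l _ => ?_
        field_simp
    _ ≤ D * ((1 / δ + 1) / P) * (X + 2 * D * (2 * Real.exp D * P / (n : ℝ) ^ θ) * Y) := by
        gcongr
    _ = _ := by
        field_simp
        ring

theorem pCoeff_nonneg {d : ℕ → ℝ} (hd : ∀ j, 0 ≤ d j) (n : ℕ) : 0 ≤ pCoeff d n := by
  rw [pCoeff_eq_expCoeff]
  exact expCoeff_nonneg hd n

theorem pCoeff_congr {d d' : ℕ → ℝ} (h : ∀ j ∈ Icc 1 n, d j = d' j) {k : ℕ} (hk : k ≤ n) :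
    pCoeff d k = pCoeff d' k := by
  rw [pCoeff_eq_expCoeff, pCoeff_eq_expCoeff]
  exact expCoeff_congr fun j hj => h j (Icc_subset_Icc_right hk hj)

theorem meanError_congr {d d' : ℕ → ℝ} {f f' : ℕ → ℂ} (hd : ∀ j ∈ Icc 1 n, d j = d' j)
    (hf : ∀ j ∈ Icc 1 n, f j = f' j) : meanError d n f = meanError d' n f' := by
  rw [meanError, meanError, weightedMean_eq_div, weightedMean_eq_div, expCoeff_congr hd,
    expCoeff_congr (a := fun j => (d j : ℂ) * f j) fun j hj => by rw [hd j hj, hf j hj],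
    sum_congr rfl fun j hj => by rw [hd j hj, hf j hj]]

theorem meanError_le_mul_of_variationIntegral_le {W : ℝ} (hδ : 0 < δ) (hθ₀ : 0 ≤ θ) (hθ₁ : θ ≤ 1)
    (hθδ : θ ≤ δ) (hd : ∀ j, δ ≤ d j) (hdD : ∀ j, d j ≤ D) (hf : ∀ j, ‖f j‖ ≤ 1) (hn : 1 ≤ n)
    (hW : 0 < W) {w : ℕ → ℝ} (hw : ∀ l ∈ Icc 1 n, variationIntegral θ n l ≤ W * w l) :
    meanError d n f ≤ D * (1 / δ + 1) * (1 + 4 * D * Real.exp D * W) *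
      ((∑ j ∈ range (n + 1), pCoeff d j)⁻¹ * ∑ k ∈ Icc 1 n, ‖f k - 1‖ * pCoeff d (n - k) +
        1 / (n : ℝ) ^ θ * ∑ k ∈ Icc 1 n, ‖f k - 1‖ * w k) := by
  have hd₀ : ∀ j, 0 ≤ d j := fun j => hδ.le.trans (hd j)
  have hD : 0 ≤ D := (hd₀ 0).trans (hdD 0)
  have hw₀ : ∀ l ∈ Icc 1 n, 0 ≤ w l := fun l hl =>
    nonneg_of_mul_nonneg_right ((variationIntegral_nonneg θ n l).trans (hw l hl)) hW
  have hX : 0 ≤ (∑ j ∈ range (n + 1), pCoeff d j)⁻¹ *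
      ∑ k ∈ Icc 1 n, ‖f k - 1‖ * pCoeff d (n - k) :=
    mul_nonneg (inv_nonneg.2 (sum_nonneg fun j _ => pCoeff_nonneg hd₀ j))
      (sum_nonneg fun k _ => mul_nonneg (norm_nonneg _) (pCoeff_nonneg hd₀ _))
  have hY : 0 ≤ 1 / (n : ℝ) ^ θ * ∑ k ∈ Icc 1 n, ‖f k - 1‖ * w k :=
    mul_nonneg (by positivity) (sum_nonneg fun k hk => mul_nonneg (norm_nonneg _) (hw₀ k hk))
  have hsum : ∑ k ∈ Icc 1 n, ‖f k - 1‖ * variationIntegral θ n k ≤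
      W * ∑ k ∈ Icc 1 n, ‖f k - 1‖ * w k := by
    rw [mul_sum]
    exact sum_le_sum fun k hk =>
      (mul_le_mul_of_nonneg_left (hw k hk) (norm_nonneg _)).trans_eq (mul_left_comm _ _ _)
  refine (meanError_le hδ hθ₀ hθ₁ hθδ hd hdD hf hn).trans ?_
  set X := (∑ j ∈ range (n + 1), pCoeff d j)⁻¹ * ∑ k ∈ Icc 1 n, ‖f k - 1‖ * pCoeff d (n - k)
  set G := 4 * D * Real.exp D * W
  have hG₀ : 0 ≤ G := by positivity
  calc D * (1 / δ + 1) * (X + 4 * D * Real.exp D *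
        (1 / (n : ℝ) ^ θ * ∑ k ∈ Icc 1 n, ‖f k - 1‖ * variationIntegral θ n k))
      ≤ D * (1 / δ + 1) * (X + 4 * D * Real.exp D *
        (1 / (n : ℝ) ^ θ * (W * ∑ k ∈ Icc 1 n, ‖f k - 1‖ * w k))) := by gcongr
    _ = D * (1 / δ + 1) * (1 * X + G * (1 / (n : ℝ) ^ θ * ∑ k ∈ Icc 1 n, ‖f k - 1‖ * w k)) := by
        ring
    _ ≤ D * (1 / δ + 1) * ((1 + G) * X +
          (1 + G) * (1 / (n : ℝ) ^ θ * ∑ k ∈ Icc 1 n, ‖f k - 1‖ * w k)) := by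
        gcongr <;> linarith
    _ = _ := by ring

theorem exists_meanError_le {W : ℝ} (hδ : 0 < δ) (hδD : δ ≤ D) (hθ₀ : 0 ≤ θ) (hθ₁ : θ ≤ 1)
    (hθδ : θ ≤ δ) (hW : 0 < W) {w : ℕ → ℕ → ℝ}
    (hw : ∀ n, ∀ l ∈ Icc 1 n, variationIntegral θ n l ≤ W * w n l) :
    ∃ C : ℝ, 0 < C ∧ ∀ n : ℕ, 1 ≤ n → ∀ (d : ℕ → ℝ) (f : ℕ → ℂ),
      (∀ j ∈ Icc 1 n, δ ≤ d j ∧ d j ≤ D) → (∀ j ∈ Icc 1 n, ‖f j‖ ≤ 1) →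
        meanError d n f ≤ C * ((∑ j ∈ range (n + 1), pCoeff d j)⁻¹ *
          ∑ k ∈ Icc 1 n, ‖f k - 1‖ * pCoeff d (n - k) +
            1 / (n : ℝ) ^ θ * ∑ k ∈ Icc 1 n, ‖f k - 1‖ * w n k) := by
  have hD : 0 < D := hδ.trans_le hδD
  refine ⟨D * (1 / δ + 1) * (1 + 4 * D * Real.exp D * W), by positivity,
    fun n hn d f hd hf => ?_⟩
  -- Only the values on `Icc 1 n` matter, so the sequences may be frozen outside it.
  set c : ℕ → ℕ := fun j => max 1 (min j n)
  have hc_mem : ∀ j, c j ∈ Icc 1 n := fun j =>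
    mem_Icc.2 ⟨le_max_left _ _, max_le hn (min_le_right _ _)⟩
  have hc : ∀ j ∈ Icc 1 n, j = c j := fun j hj => by
    rw [mem_Icc] at hj
    simp only [c, min_eq_left hj.2, max_eq_right hj.1]
  have hdc : ∀ j ∈ Icc 1 n, d j = d (c j) := fun j hj => congrArg d (hc j hj)
  have hfc : ∀ j ∈ Icc 1 n, f j = f (c j) := fun j hj => congrArg f (hc j hj)
  have hp : ∀ k ≤ n, pCoeff d k = pCoeff (fun j => d (c j)) k := fun k => pCoeff_congr hdc
  have hP : ∑ j ∈ range (n + 1), pCoeff d j =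
      ∑ j ∈ range (n + 1), pCoeff (fun j => d (c j)) j :=
    sum_congr rfl fun j hj => hp j (Nat.lt_succ_iff.1 (mem_range.1 hj))
  have hX : ∑ k ∈ Icc 1 n, ‖f k - 1‖ * pCoeff d (n - k) =
      ∑ k ∈ Icc 1 n, ‖f (c k) - 1‖ * pCoeff (fun j => d (c j)) (n - k) :=
    sum_congr rfl fun k hk => by rw [← hfc k hk, hp _ (n.sub_le k)]
  have hY : ∑ k ∈ Icc 1 n, ‖f k - 1‖ * w n k = ∑ k ∈ Icc 1 n, ‖f (c k) - 1‖ * w n k :=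
    sum_congr rfl fun k hk => by rw [← hfc k hk]
  rw [meanError_congr hdc hfc, hP, hX, hY]
  exact meanError_le_mul_of_variationIntegral_le hδ hθ₀ hθ₁ hθδ (fun j => (hd _ (hc_mem j)).1)
    (fun j => (hd _ (hc_mem j)).2) (fun j => hf _ (hc_mem j)) hn hW (hw n)

end MeanError

theorem theorem3 (dminus dplus : ℝ) (hdminus : 0 < dminus) :
    ∃ c₁ : ℝ, 0 < c₁ ∧
      ∀ (n : ℕ), 1 ≤ n → ∀ (dhat : ℕ → ℝ) (fhat : ℕ → ℂ),
        (∀ j ∈ Finset.Icc 1 n, dminus ≤ dhat j ∧ dhat j ≤ dplus) →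
        (∀ j ∈ Finset.Icc 1 n, ‖fhat j‖ ≤ 1) →
          (∀ k : ℕ, pCoeff dhat k = PowerSeries.coeff k (genSeries dhat)) ∧
          (dminus < 1 →
            meanError dhat n fhat ≤
              c₁ * ((∑ j ∈ Finset.range (n + 1), pCoeff dhat j)⁻¹
                      * ∑ k ∈ Finset.Icc 1 n, ‖fhat k - 1‖ * pCoeff dhat (n - k)
                    + 1 / (n : ℝ) ^ dminus
                      * ∑ k ∈ Finset.Icc 1 n, ‖fhat k - 1‖ * (k : ℝ) ^ (dminus - 1)
                    + 1 / (n : ℝ) * ∑ k ∈ Finset.Icc 1 n, ‖fhat k - 1‖)) ∧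
          (1 ≤ dminus →
            meanError dhat n fhat ≤
              c₁ * ((∑ j ∈ Finset.range (n + 1), pCoeff dhat j)⁻¹
                      * ∑ k ∈ Finset.Icc 1 n, ‖fhat k - 1‖ * pCoeff dhat (n - k)
                    + 1 / (n : ℝ)
                      * ∑ k ∈ Finset.Icc 1 n,
                          ‖fhat k - 1‖ * (1 + Real.log ((n : ℝ) / (k : ℝ))))) := by
  set D := max dminus dplus
  have hbounds : ∀ (n : ℕ) (dhat : ℕ → ℝ), (∀ j ∈ Icc 1 n, dminus ≤ dhat j ∧ dhat j ≤ dplus) →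
      ∀ j ∈ Icc 1 n, dminus ≤ dhat j ∧ dhat j ≤ D :=
    fun n dhat hd j hj => ⟨(hd j hj).1, (hd j hj).2.trans (le_max_right _ _)⟩
  rcases lt_or_ge dminus 1 with hlt | hge
  · have : 0 < 1 - dminus := sub_pos.2 hlt
    obtain ⟨C, hC, hmean⟩ := exists_meanError_le (w := fun _ l => (l : ℝ) ^ (dminus - 1))
      hdminus (le_max_left _ dplus) hdminus.le hlt.le le_rfl (by positivity) fun n l hl =>
        variationIntegral_le hdminus.le hlt (mem_Icc.1 hl).1
    refine ⟨C, hC, fun n hn dhat fhat hd hf =>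
      ⟨pCoeff_eq_coeff_genSeries dhat, fun _ => ?_, fun hge => absurd hge hlt.not_ge⟩⟩
    refine (hmean n hn dhat fhat (hbounds n dhat hd) hf).trans
      (mul_le_mul_of_nonneg_left (le_add_of_nonneg_right ?_) hC.le)
    positivity
  · obtain ⟨C, hC, hmean⟩ := exists_meanError_le
      (w := fun n l => 1 + Real.log ((n : ℝ) / l))
      hdminus (le_max_left _ dplus) zero_le_one le_rfl hge (by positivity) fun n l hl =>
        variationIntegral_one_le (mem_Icc.1 hl).1 (mem_Icc.1 hl).2
    refine ⟨C, hC, fun n hn dhat fhat hd hf =>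
      ⟨pCoeff_eq_coeff_genSeries dhat, fun hlt => absurd hge hlt.not_ge, fun _ => ?_⟩⟩
    simpa only [Real.rpow_one] using hmean n hn dhat fhat (hbounds n dhat hd) hf
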